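/- **Theorem (Safety of the Chora replication protocol).** Let $f\ge 0$ and let $N=2f+1$ replicas run the Chora protocol described below, over an asynchronous network that may lose, delay, reorder and duplicate messages, where any replica may crash at any time and otherwise follows the protocol. In every execution: if a command $c$ is committed at log slot $s$ (that is, some replica has $s\le\textit{last-commit}$ and $c$ at slot $s$ of its log), then no other command is ever committed at $s$, by any replica, at any later (or the same) time. Commands are compared together with the view attached to them. *Local state.* Each replica has a log (a partial map from slots to commands with an attached view; at slot $0$ there is a null command of view $0$), a view (initially $0$), a role (initiator, candidate or follower), a set *voted-by*, an optional *view-base* and *next-propose*, indices *last-append*, *last-ack* and *last-commit* (initially $0$), and an index *acked*$[r]$ for each replica $r$. The commands at slots $\le\textit{last-append}$ are the appended ones; those at larger slots are buffered. All messages carry the sender's view, and messages of a view lower than the receiver's are ignored. *Modes.* Each replica is in responsive mode (messages are sent at once) or in pulsing mode (messages are sent at the replica's next pulse) and may switch at any time. Timeouts, suspicions and client requests may occur at any time. *Entering a view $v$* means: clear the buffered commands, set the view to $v$, *view-base* and *next-propose* to null, *acked* to $0$, *last-ack* to *last-commit*. *View change.* A replica may enter a higher view as a candidate, vote for itself, and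 multicast its last appended slot and that slot's attached view. A replica in a lower view whose last appended slot $t$ has attached view $u$ may, if the candidate's pair (slot $t'$, view $u'$) satisfies $u'>u$, or $u'=u$ and $t'\ge t$, enter the candidate's view as a follower and reply with a vote. A candidate with $f+1$ votes becomes the initiator: it proposes, appends and acknowledges a *view-init* at *view-base* $=\textit{last-append}+1$, which assigns each later slot to one replica. *Proposals.* When *view-init* is locally committed, *next-propose* becomes the replica's first assigned slot after *view-base*. A replica may propose client operations or a no-op at *next-propose*; it puts the proposal in its own log, multicasts it with its *last-ack*, and moves *next-propose* to its next assigned slot. It may multicast its own proposals of the current view again. A replica that receives a proposal of a higher view enters that view as a follower; a candidate that receives one of its own view becomes a follower. On first receipt of the *view-init* of its view, for slot $b$, a replica becomes a follower, sets *view-base* to $b$, clears its log from slot $b$ on and puts the *view-init* there. Any other proposal of the current view is buffered if its slot is empty and beyond *last-append*. *Recovery.* A replica may ask for any slot. Another replica in the same view may answer with the command in its log at that slot (with its attached view), if the slot is at most its *last-ack* or the command was proposed in the current view. A replica that has received the *view-init* of its view and receives such an answer for a slot $s$ does nothing if $s\le\textit{last-ack}$. If $\textit{last-ack}<s\le\textit{last-append}$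 and its own command at $s$ has the same attached view, it sets *last-ack* to $s$; if the views differ, it clears its appended commands from $s$ on, so that *last-append* becomes $s-1$, and buffers the received command at $s$. If $s>\textit{last-append}$ and slot $s$ is empty, it buffers the received command. A recovered *view-init* of the current view that is received for the first time is treated like a proposed one. *Append, acknowledge, commit.* After receiving the *view-init* of its view, a replica with $\textit{last-ack}=\textit{last-append}$ whose next slot is non-empty may append that slot, increasing both indices by one. It may multicast *last-ack* at any time; receivers in the same view store it in *acked*. A replica that knows *view-base* may raise *last-commit* to any $k$ with $\textit{view-base}\le k\le\textit{last-ack}$ for which at least $f+1$ replicas, itself included, have acknowledged $k$ in the current view according to its *acked*. -/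

import Mathlib

namespace Chora

/-- The `N = 2f + 1` replicas. -/
abbrev Replica (f : ℕ) : Type := Fin (2 * f + 1)

/-- Commands. `request ops` is a batch of client operations; `viewInit owner` opens a view and
carries its slot assignment scheme: `owner n` is the only replica that may propose at slot `n`.
`null` is the fixed content of slot `0`. -/
inductive Command (f : ℕ) (α : Type*) where
  | null
  | noop
  | request (ops : List α)
  | viewInit (owner : ℕ → Replica f)

/-- A command together with the view that is attached to it (the view in which it is proposed). -/
structure Entry (f : ℕ) (α : Type*) where
  view : ℕ
  cmd : Command f α

def Entry.IsViewInit {f : ℕ} {α : Type*} (e : Entry f α) : Prop :=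
  ∃ owner, e.cmd = Command.viewInit owner

/-- Messages, all tagged with the sender's view. A `propose-noop` is a `propose` whose command is
`noop`; a `skip` stands for several of those. -/
inductive Message (f : ℕ) (α : Type*) where
  | propose (view logSlot ackSlot : ℕ) (cmd : Command f α)
  | proposeAck (view ackSlot : ℕ)
  | proposeNack (view nackSlot : ℕ)
  | proposeRecover (view recoverSlot : ℕ) (entry : Entry f α)
  | viewChangeRequest (newView lastAppendSlot lastAppendView : ℕ)
  | viewChangeReply (newView : ℕ) (votedFor : Replica f)

inductive Role where
  | initiator
  | candidate
  | follower

inductive Mode where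
  | pulsing
  | responsive

/-- Local state of a replica.

The commands at slots `≤ lastAppend` are the appended commands. Commands at larger slots are
proposals that are buffered in the log: they become appended in slot order, and only after
everything below has been confirmed in the current view (`LocalStep.append`). -/
structure Local (f : ℕ) (α : Type*) where
  log : ℕ → Option (Entry f α)
  view : ℕ
  role : Role
  votedFor : Option (Replica f)
  votedBy : Finset (Replica f)
  /-- first slot of the current view, once its `viewInit` has been received -/
  viewBase : Option ℕ
  nextPropose : Option ℕ
  lastAppend : ℕ
  lastAck : ℕ
  lastCommit : ℕ
  acked : Replica f → ℕ
  mode : Mode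
  /-- messages that wait for the next pulse -/
  outbox : Set (Message f α)

/-- Initially the log holds only the `null` command (of view `0`) at slot `0`. -/
def Local.start (f : ℕ) (α : Type*) : Local f α where
  log := fun n => if n = 0 then some ⟨0, Command.null⟩ else none
  view := 0
  role := Role.follower
  votedFor := none
  votedBy := ∅
  viewBase := none
  nextPropose := none
  lastAppend := 0
  lastAck := 0
  lastCommit := 0
  acked := fun _ => 0
  mode := Mode.responsive
  outbox := ∅

/-- The packets (sender and message) that have been sent. Packets are never removed, and reception
is never forced: loss, delay, reordering and duplication are all possible. -/
abbrev Network (f : ℕ) (α : Type*) : Type _ := Set (Replica f × Message f α)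

section Handlers

variable {f : ℕ} {α : Type*}

/-- View of the last appended command. -/
def Local.lastAppendView (s : Local f α) : ℕ :=
  match s.log s.lastAppend with
  | some e => e.view
  | none => 0

/-- A log whose last appended slot is `n`, with attached view `v`, is at least as up-to-date as a
log whose last appended slot is `n'`, with attached view `v'`. -/
def AtLeastAsUpToDate (v n v' n' : ℕ) : Prop :=
  v' < v ∨ (v = v' ∧ n' ≤ n)

/-- The slot assignment scheme of the current view, if its `viewInit` has been received. -/
def Local.scheme (s : Local f α) : Option (ℕ → Replica f) :=
  match s.viewBase with
  | none => none
  | some b =>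
    match s.log b with
    | some ⟨_, Command.viewInit owner⟩ => some owner
    | _ => none

open Classical in
/-- The first slot after `n` that is assigned to `r`. -/
noncomputable def nextAssigned (owner : ℕ → Replica f) (r : Replica f) (n : ℕ) : Option ℕ :=
  if h : ∃ m, n < m ∧ owner m = r then some (Nat.find h) else none

/-- The updates made when a replica moves to the view `v`. -/
def Local.enterView (s : Local f α) (v : ℕ) (role : Role) (votedFor : Option (Replica f))
    (votedBy : Finset (Replica f)) : Local f α :=
  { s with
    log := fun n => if n ≤ s.lastAppend then s.log n else none
    view := v
    role := role
    votedFor := votedFor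
    votedBy := votedBy
    viewBase := none
    nextPropose := none
    lastAck := s.lastCommit
    acked := fun _ => 0 }

/-- First reception of the `viewInit` `e` of the current view, for slot `b`: all proposals from
slot `b` on are cleared, and `e` is put there. -/
def Local.learnViewInit (s : Local f α) (b : ℕ) (e : Entry f α) : Local f α :=
  { s with
    log := fun n => if n < b then s.log n else if n = b then some e else none
    role := Role.follower
    viewBase := some b
    lastAppend := min s.lastAppend (b - 1) }

open Classical in
/-- Put a proposal in the log, as a buffered one. A nonempty slot is left as it is. -/
noncomputable def Local.buffer (s : Local f α) (n : ℕ) (e : Entry f α) : Local f α :=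
  if s.lastAppend < n ∧ s.log n = none then
    { s with log := Function.update s.log n (some e) }
  else s

open Classical in
/-- Processing of a proposal `e` of the current view for slot `n`. -/
noncomputable def Local.deliver (s : Local f α) (n : ℕ) (e : Entry f α) : Local f α :=
  if e.IsViewInit ∧ s.viewBase = none then s.learnViewInit n e else s.buffer n e

/-- What a replica does before it processes a `propose` of view `v`: if `v` is higher than its own
view it becomes a follower in `v`; if it is a candidate in `v` it gives up its candidacy. -/
def Local.followProposal (s : Local f α) (v : ℕ) : Local f α :=
  if s.view < v then s.enterView v Role.follower none ∅
  else
    match s.role with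
    | Role.candidate => { s with role := Role.follower }
    | _ => s

/-- A `proposeRecover` contradicts the unconfirmed appended command at slot `n`: the appended
commands from slot `n` on are cleared, and the recovered command is buffered at `n`. -/
def Local.replaceFrom (s : Local f α) (n : ℕ) (e : Entry f α) : Local f α :=
  { s with
    log := fun m =>
      if m = n then some e else if n < m ∧ m ≤ s.lastAppend then none else s.log m
    lastAppend := n - 1 }

open Classical in
/-- Processing of a `proposeRecover` of the current view, with the command `e` for slot `n`. -/
noncomputable def Local.deliverRecover (s : Local f α) (n : ℕ) (e : Entry f α) : Local f α :=
  if s.viewBase = none then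
    if e.IsViewInit ∧ e.view = s.view then s.learnViewInit n e else s
  else if n ≤ s.lastAck then s
  else if n ≤ s.lastAppend then
    if (s.log n).map Entry.view = some e.view then { s with lastAck := n }
    else s.replaceFrom n e
  else s.buffer n e

def Local.receiveAck (s : Local f α) (r : Replica f) (n : ℕ) : Local f α :=
  { s with acked := Function.update s.acked r n }

/-- The candidate `s` becomes the initiator and proposes `viewInit owner` right after its last
appended slot. -/
def Local.initiate (s : Local f α) (owner : ℕ → Replica f) : Local f α :=
  { s with
    log := Function.update s.log (s.lastAppend + 1) (some ⟨s.view, Command.viewInit owner⟩)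
    role := Role.initiator
    viewBase := some (s.lastAppend + 1)
    lastAppend := s.lastAppend + 1
    lastAck := s.lastAppend + 1 }

/-- A proposal at slot `n` is put in the proposer's own log, and `nextPropose` is advanced. -/
noncomputable def Local.proposeAt (s : Local f α) (me : Replica f) (owner : ℕ → Replica f)
    (n : ℕ) (c : Command f α) : Local f α :=
  { s with
    log := Function.update s.log n (some ⟨s.view, c⟩)
    nextPropose := nextAssigned owner me n }

/-- `lastCommit` is advanced to `k`. If this commits the `viewInit` of the current view, at slot
`b`, the new assignment scheme takes effect. -/
noncomputable def Local.commitUpTo (s : Local f α) (me : Replica f) (b k : ℕ) : Local f α :=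
  { s with
    lastCommit := k
    nextPropose :=
      if s.lastCommit < b then s.scheme.bind (fun owner => nextAssigned owner me b)
      else s.nextPropose }

end Handlers

/-- `LocalStep me net s s' out`: when the packets in `net` have been sent, the replica `me` can go
from the local state `s` to `s'` and issue the messages in `out`.

Timeouts, suspicions and client requests may occur at any time, so the steps they trigger are
always enabled. A message can be processed at any time, or never. -/
inductive LocalStep {f : ℕ} {α : Type*} (me : Replica f) (net : Network f α) :
    Local f α → Local f α → Set (Message f α) → Prop
  /-- Become a candidate of a higher view and vote for oneself. -/
  | startElection (s : Local f α) (v : ℕ) (hv : s.view < v) :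
      LocalStep me net s (s.enterView v Role.candidate (some me) {me})
        {Message.viewChangeRequest v s.lastAppend s.lastAppendView}
  /-- Vote for a candidate of a higher view whose log is at least as up-to-date. (A replica that
  refuses starts a still higher view by `startElection`.) -/
  | vote (s : Local f α) (r : Replica f) (v n w : ℕ)
      (hm : (r, Message.viewChangeRequest v n w) ∈ net) (hv : s.view < v)
      (hlog : AtLeastAsUpToDate w n s.lastAppendView s.lastAppend) :
      LocalStep me net s (s.enterView v Role.follower (some r) ∅) {Message.viewChangeReply v r}
  | receiveVote (s : Local f α) (r : Replica f)
      (hm : (r, Message.viewChangeReply s.view me) ∈ net) (hrole : s.role = Role.candidate) :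
      LocalStep me net s { s with votedBy := insert r s.votedBy } ∅
  /-- With a quorum of votes, become the initiator and propose the `viewInit` of the view. -/
  | becomeInitiator (s : Local f α) (owner : ℕ → Replica f)
      (hrole : s.role = Role.candidate) (hquorum : f + 1 ≤ s.votedBy.card) :
      LocalStep me net s (s.initiate owner)
        {Message.propose s.view (s.lastAppend + 1) (s.lastAppend + 1) (Command.viewInit owner)}
  /-- Propose a batch of client operations or a `noop` at the next assigned slot. -/
  | propose (s : Local f α) (owner : ℕ → Replica f) (n : ℕ) (c : Command f α)
      (hnext : s.nextPropose = some n) (hscheme : s.scheme = some owner)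
      (hc : c = Command.noop ∨ ∃ ops, c = Command.request ops) :
      LocalStep me net s (s.proposeAt me owner n c) {Message.propose s.view n s.lastAck c}
  /-- Multicast again an own proposal of the current view. -/
  | proposeAgain (s : Local f α) (n a : ℕ) (c : Command f α)
      (hm : (me, Message.propose s.view n a c) ∈ net) :
      LocalStep me net s s {Message.propose s.view n s.lastAck c}
  | sendAck (s : Local f α) :
      LocalStep me net s s {Message.proposeAck s.view s.lastAck}
  | sendNack (s : Local f α) (n : ℕ) :
      LocalStep me net s s {Message.proposeNack s.view n}
  /-- Answer a `proposeNack` with a command that is confirmed in the current view or that was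
  proposed in it. -/
  | answerNack (s : Local f α) (r : Replica f) (n : ℕ) (e : Entry f α)
      (hm : (r, Message.proposeNack s.view n) ∈ net) (hlog : s.log n = some e)
      (hok : n ≤ s.lastAck ∨ e.view = s.view) :
      LocalStep me net s s {Message.proposeRecover s.view n e}
  | receivePropose (s : Local f α) (r : Replica f) (v n a : ℕ) (c : Command f α)
      (hm : (r, Message.propose v n a c) ∈ net) (hv : s.view ≤ v) :
      LocalStep me net s (((s.followProposal v).deliver n ⟨v, c⟩).receiveAck r a) ∅
  | receiveAck (s : Local f α) (r : Replica f) (a : ℕ)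
      (hm : (r, Message.proposeAck s.view a) ∈ net) :
      LocalStep me net s (s.receiveAck r a) ∅
  | receiveRecover (s : Local f α) (r : Replica f) (n : ℕ) (e : Entry f α)
      (hm : (r, Message.proposeRecover s.view n e) ∈ net) :
      LocalStep me net s (s.deliverRecover n e) ∅
  /-- When all appended commands are confirmed, the next slot, if it is not empty, is appended and
  acknowledged. This needs the `viewInit` of the current view to have been received. -/
  | append (s : Local f α) (b : ℕ) (e : Entry f α) (hbase : s.viewBase = some b)
      (hconf : s.lastAck = s.lastAppend) (hlog : s.log (s.lastAppend + 1) = some e) :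
      LocalStep me net s
        { s with lastAppend := s.lastAppend + 1, lastAck := s.lastAppend + 1 } ∅
  /-- Commit all slots up to `k`, which the replica itself and altogether a quorum of replicas have
  acknowledged in the current view. No commit happens below the `viewInit` of the view alone. -/
  | commit (s : Local f α) (b k : ℕ) (hbase : s.viewBase = some b) (hbk : b ≤ k)
      (hnew : s.lastCommit < k) (hown : k ≤ s.lastAck)
      (hquorum : f + 1 ≤ (Finset.univ.filter (fun r => r = me ∨ k ≤ s.acked r)).card) :
      LocalStep me net s (s.commitUpTo me b k) ∅
  | switchMode (s : Local f α) (m : Mode) :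
      LocalStep me net s { s with mode := m } ∅

/-- Global state of the system. -/
structure State (f : ℕ) (α : Type*) where
  replica : Replica f → Local f α
  net : Network f α
  crashed : Set (Replica f)

def State.start (f : ℕ) (α : Type*) : State f α where
  replica := fun _ => Local.start f α
  net := ∅
  crashed := ∅

/-- One step of the system. The messages issued by a replica are sent immediately in responsive
mode; in pulsing mode they wait for the replica's next pulse. -/
inductive Step {f : ℕ} {α : Type*} : State f α → State f α → Prop
  | responsive (σ : State f α) (r : Replica f) (s' : Local f α) (out : Set (Message f α))
      (hr : r ∉ σ.crashed) (hmode : (σ.replica r).mode = Mode.responsive)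
      (h : LocalStep r σ.net (σ.replica r) s' out) :
      Step σ { σ with
        replica := Function.update σ.replica r s'
        net := σ.net ∪ {p | p.1 = r ∧ p.2 ∈ out} }
  | pulsing (σ : State f α) (r : Replica f) (s' : Local f α) (out : Set (Message f α))
      (hr : r ∉ σ.crashed) (hmode : (σ.replica r).mode = Mode.pulsing)
      (h : LocalStep r σ.net (σ.replica r) s' out) :
      Step σ { σ with
        replica := Function.update σ.replica r { s' with outbox := s'.outbox ∪ out } }
  | pulse (σ : State f α) (r : Replica f) (hr : r ∉ σ.crashed) :
      Step σ { σ with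
        replica := Function.update σ.replica r { σ.replica r with outbox := ∅ }
        net := σ.net ∪ {p | p.1 = r ∧ p.2 ∈ (σ.replica r).outbox} }
  | crash (σ : State f α) (r : Replica f) :
      Step σ { σ with crashed := insert r σ.crashed }

/-- The command `c` (with its attached view) is committed at slot `n`: it is locally committed in
the log of some replica. -/
def State.Committed {f : ℕ} {α : Type*} (σ : State f α) (n : ℕ) (c : Entry f α) : Prop :=
  ∃ r, n ≤ (σ.replica r).lastCommit ∧ (σ.replica r).log n = some c

end Chora

/-!
The protocol is Raft-like, and its safety comes from a *history*: auxiliary data that the steps of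
an execution only ever extend. For each view `v` it records the slot `base v` of its `viewInit`,
its leader, a *canonical log* `canon v` (the log of the initiator when it opened `v`, followed by
the proposals of `v`, each slot having at most one since it has one owner, who proposes in
increasing slots), the highest slot each replica has appended and acknowledged in `v`, the votes,
and all messages ever issued. A slot `k ≥ base v` is *chosen* in `v` if a quorum has acknowledged
it there; what a replica commits is the canonical log of a view up to a chosen slot.

Logs match as in Raft: an appended entry of view `u` at slot `n` forces the log up to `n` to agree
with `canon u`. This is what makes it sound to confirm a whole prefix when a recovered entry has
the right view at a single slot.

The heart is `History.Inv.preserves`: if `k` is chosen in `v`, every later opened view `w` has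
`base w > k` and agrees with `canon v` up to `k`. By induction on `w`: the quorum that acknowledged
`k` shares a replica `q` with the quorum that elected the leader of `w`. As long as the views
opened so far preserve `k`, nothing makes `q` drop slot `k` (`Local.AckInv.retained`), so the
elected log was at least as up-to-date as one that holds `k`; it ends either in view `v` at a slot
`≥ k`, or in a view strictly between `v` and `w`, where the induction hypothesis applies. Both
"`q` still holds `k`" and "the elected log dominates that of `q`" (`History.Dominates`) are stated
*under the hypothesis* that the intermediate views preserve `k`. Opening more views only strengthens
this hypothesis, so these facts are stable, and `preserves` itself is a consequence of the invariant
at one instant, not a separate induction on executions.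

The rest is the invariance proof: each local step is matched by an extension of the history
(`LocalStep.explains`). Two commands committed at one slot then both lie in canonical logs up to
chosen slots of the final history, and hence are equal.
-/

namespace Chora

variable {f : ℕ} {α : Type*}

/-! ### Histories -/

/-- Auxiliary record of an execution. It grows monotonically in the sense of `History.Ext`. -/
structure History (f : ℕ) (α : Type*) where
  /-- the slot of the `viewInit` of a view; view `0`, which has none, gets base `0` -/
  base : ℕ → Option ℕ
  /-- the initiator of a view; only meaningful where `base` is defined -/
  leader : ℕ → Replica f
  /-- the canonical log of a view, by slot -/
  canon : ℕ → ℕ → Option (Entry f α)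
  /-- the highest slot that a replica has appended or confirmed in a view since it learned the
  `viewInit` of that view -/
  acked : ℕ → Replica f → ℕ
  /-- the candidate a replica has voted for in a view -/
  vote : ℕ → Replica f → Option (Replica f)
  /-- the messages issued so far, including those that still wait for a pulse -/
  sent : Network f α

namespace History

/-- A quorum has acknowledged slot `k`, which is not below the base of `v`, in the view `v`. -/
def Chosen (g : History f α) (v k : ℕ) : Prop :=
  ∃ b, ∃ Q : Finset (Replica f), g.base v = some b ∧ b ≤ k ∧ f + 1 ≤ Q.card ∧
    ∀ q ∈ Q, k ≤ g.acked v q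

/-- If the view `x` has been opened, this happened above slot `k` and on top of the canonical log of
`v` up to `k`. Vacuous as long as `x` has not been opened. -/
def Preserves (g : History f α) (x v k : ℕ) : Prop :=
  ∀ b, g.base x = some b → k < b ∧ ∀ m ≤ k, ∀ e, g.canon v m = some e → g.canon x m = some e

/-- A log ending at slot `t` with attached view `u` is at least as up-to-date as any slot that the
replica `q` had acknowledged in views below `w`, insofar as the views opened in between preserve
that slot. The proviso makes the property stable: opening a view only strengthens it. -/
def Dominates (g : History f α) (w : ℕ) (q : Replica f) (u t : ℕ) : Prop :=
  ∀ v b k, v < w → g.base v = some b → b ≤ k → k ≤ g.acked v q →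
    (∀ x, v < x → x < w → g.Preserves x v k) → v < u ∨ (v = u ∧ k ≤ t)

/-- What it means that `q` announces `a` as its `lastAck` in view `v`. Before `q` has learned the
`viewInit` of `v`, its `lastAck` is its `lastCommit`, which earlier views have chosen. -/
def Acknowledged (g : History f α) (v : ℕ) (q : Replica f) (a : ℕ) : Prop :=
  a ≤ g.acked v q ∨ ∃ u k, u < v ∧ a ≤ k ∧ g.Chosen u k

/-- `e` may be handed out as the entry at slot `n` in view `v`: it is in the canonical log of `v`, or
has been chosen earlier and therefore will be in it once `v` is opened. -/
def Known (g : History f α) (v n : ℕ) (e : Entry f α) : Prop :=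
  g.canon v n = some e ∨ ∃ u k, u < v ∧ n ≤ k ∧ g.Chosen u k ∧ g.canon u n = some e

/-- What a message issued by `r` guarantees. A `viewChangeRequest` describes the log of a replica that
is still a candidate, which is part of `Local.ElectionInv`. -/
def MsgValid (g : History f α) (r : Replica f) : Message f α → Prop
  | .propose v n a c => v ≠ 0 ∧ g.canon v n = some ⟨v, c⟩ ∧ g.Acknowledged v r a
  | .proposeAck v a => g.Acknowledged v r a
  | .proposeNack _ _ => True
  | .proposeRecover v n e => g.Known v n e
  | .viewChangeRequest _ _ _ => True
  | .viewChangeReply w c => g.vote w r = some c ∧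
      ∃ t u, (c, Message.viewChangeRequest w t u) ∈ g.sent ∧ g.Dominates w r u t

/-- Consistency of the canonical logs. -/
structure LogInv (g : History f α) : Prop where
  base_zero : g.base 0 = some 0
  canon_view : ∀ {v n e}, g.canon v n = some e →
    e.view ≤ v ∧ ∃ b, g.base v = some b ∧ (e.view = v ↔ b ≤ n)
  canon_defined : ∀ {v b m}, g.base v = some b → m ≤ b → ∃ e, g.canon v m = some e
  base_pos : ∀ {v b}, g.base v = some b → v ≠ 0 → 0 < b
  viewInit : ∀ {v n e}, g.canon v n = some e → e.view = v → e.IsViewInit →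
    g.base v = some n ∧ v ≠ 0
  matching : ∀ {v n m e e'}, g.canon v n = some e → m ≤ n → g.canon v m = some e' →
    g.canon e.view m = some e'
  acked_none : ∀ {v} q, g.base v = none → g.acked v q = 0

/-- The leader of `w` had the votes of a quorum, all dominated by the last entry below the base `b`,
which is the entry its own log ended with at the election. -/
def Elected (g : History f α) (w b : ℕ) : Prop :=
  ∃ e, ∃ Q : Finset (Replica f), g.canon w (b - 1) = some e ∧ f + 1 ≤ Q.card ∧
    ∀ q ∈ Q, g.vote w q = some (g.leader w) ∧ g.Dominates w q e.view (b - 1)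

/-- The invariant of the history alone. -/
structure Inv (g : History f α) : Prop extends LogInv g where
  elected : ∀ {w b}, g.base w = some b → w ≠ 0 → g.Elected w b
  msgs : ∀ {r m}, (r, m) ∈ g.sent → g.MsgValid r m

/-- `g'` extends `g`. A vote for view `w` freezes the acknowledgements of the voter below `w`. -/
structure Ext (g g' : History f α) : Prop where
  base : ∀ {v b}, g.base v = some b → g'.base v = some b
  leader : ∀ {v b}, g.base v = some b → g'.leader v = g.leader v
  canon : ∀ {v n e}, g.canon v n = some e → g'.canon v n = some e
  acked : ∀ v q, g.acked v q ≤ g'.acked v q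
  vote : ∀ {v q c}, g.vote v q = some c → g'.vote v q = some c
  sent : g.sent ⊆ g'.sent
  frozen : ∀ {w q c v}, g.vote w q = some c → v < w → g'.acked v q = g.acked v q
  base_pos : ∀ {v b}, g.base v = none → g'.base v = some b → 0 < b

theorem Ext.refl (g : History f α) : g.Ext g :=
  ⟨id, fun _ => rfl, id, fun _ _ => le_rfl, id, subset_rfl, fun _ _ => rfl, by simp_all⟩

theorem Ext.trans {g₁ g₂ g₃ : History f α} (h : g₁.Ext g₂) (h' : g₂.Ext g₃) : g₁.Ext g₃ where
  base hb := h'.base (h.base hb)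
  leader hb := (h'.leader (h.base hb)).trans (h.leader hb)
  canon hc := h'.canon (h.canon hc)
  acked v q := (h.acked v q).trans (h'.acked v q)
  vote hv := h'.vote (h.vote hv)
  sent := h.sent.trans h'.sent
  frozen hv hw := (h'.frozen (h.vote hv) hw).trans (h.frozen hv hw)
  base_pos {v b} hn hb := by
    cases hb₂ : g₂.base v with
    | none => exact h'.base_pos hb₂ hb
    | some b' =>
      have := h'.base hb₂
      rw [hb] at this
      exact Option.some.inj this ▸ h.base_pos hn hb₂

theorem LogInv.not_le_acked {g : History f α} (hg : g.LogInv) {v b k : ℕ} {q : Replica f}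
    (hb : g.base v = none) (hpos : 0 < b) (hbk : b ≤ k) : ¬ k ≤ g.acked v q := by
  rw [hg.acked_none q hb]; omega

/-! ### Stability under extension -/

section Mono

variable {g g' : History f α} (hx : g.Ext g')
include hx

theorem Chosen.mono {v k : ℕ} (h : g.Chosen v k) : g'.Chosen v k := by
  obtain ⟨b, Q, hb, hbk, hQ, hA⟩ := h
  exact ⟨b, Q, hx.base hb, hbk, hQ, fun q hq => (hA q hq).trans (hx.acked v q)⟩

theorem Acknowledged.mono {v a : ℕ} {q : Replica f} (h : g.Acknowledged v q a) :
    g'.Acknowledged v q a := by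
  rcases h with h | ⟨u, k, hu, hk, hc⟩
  · exact .inl (h.trans (hx.acked v q))
  · exact .inr ⟨u, k, hu, hk, hc.mono hx⟩

theorem Known.mono {v n : ℕ} {e : Entry f α} (h : g.Known v n e) : g'.Known v n e := by
  rcases h with h | ⟨u, k, hu, hk, hc, he⟩
  · exact .inl (hx.canon h)
  · exact .inr ⟨u, k, hu, hk, hc.mono hx, hx.canon he⟩

theorem Preserves.of_ext (hg : g.LogInv) {x v k : ℕ} (h : g'.Preserves x v k) :
    g.Preserves x v k := by
  intro b hb
  obtain ⟨hk, h⟩ := h b (hx.base hb)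
  refine ⟨hk, fun m hm e he => ?_⟩
  obtain ⟨e', he'⟩ := hg.canon_defined hb (hm.trans hk.le)
  have := h m hm e (hx.canon he)
  rw [hx.canon he'] at this
  exact he'.trans this

theorem Dominates.mono (hg : g.LogInv) {w u t : ℕ} {q c : Replica f} (hv : g.vote w q = some c)
    (h : g.Dominates w q u t) : g'.Dominates w q u t := by
  intro v b k hvw hb hbk hk hP
  rw [hx.frozen hv hvw] at hk
  cases hb' : g.base v with
  | none => exact absurd hk (hg.not_le_acked hb' (hx.base_pos hb' hb) hbk)
  | some b' =>
    have := hx.base hb'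
    rw [hb] at this
    cases this
    exact h v b k hvw hb' hbk hk fun x h1 h2 => (hP x h1 h2).of_ext hx hg

theorem MsgValid.mono (hg : g.LogInv) {r : Replica f} {m : Message f α} (h : g.MsgValid r m) :
    g'.MsgValid r m := by
  cases m with
  | propose v n a c => exact ⟨h.1, hx.canon h.2.1, h.2.2.mono hx⟩
  | proposeAck v a => exact Acknowledged.mono hx h
  | proposeNack v n => trivial
  | proposeRecover v n e => exact Known.mono hx h
  | viewChangeRequest w t u => trivial
  | viewChangeReply w c =>
    obtain ⟨hv, t, u, hs, hd⟩ := h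
    exact ⟨hx.vote hv, t, u, hx.sent hs, hd.mono hx hg hv⟩

theorem Elected.mono (hg : g.LogInv) {w b : ℕ} (hb : g.base w = some b) (h : g.Elected w b) :
    g'.Elected w b := by
  obtain ⟨e, Q, he, hQ, h⟩ := h
  refine ⟨e, Q, hx.canon he, hQ, fun q hq => ?_⟩
  rw [hx.leader hb]
  exact ⟨hx.vote (h q hq).1, (h q hq).2.mono hx hg (h q hq).1⟩

end Mono

/-! ### Chosen slots survive view changes -/

theorem exists_mem_of_quorums {Q Q' : Finset (Replica f)} (hQ : f + 1 ≤ Q.card)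
    (hQ' : f + 1 ≤ Q'.card) : ∃ q, q ∈ Q ∧ q ∈ Q' := by
  by_contra! h
  have hd : Disjoint Q Q' := Finset.disjoint_left.2 h
  have h1 := Finset.card_le_univ (Q ∪ Q')
  rw [Finset.card_union_of_disjoint hd, Fintype.card_fin] at h1
  omega

/-- Leader completeness: slots chosen in a view are kept by all later views. -/
theorem Inv.preserves {g : History f α} (hg : g.Inv) {v k : ℕ} (hc : g.Chosen v k) :
    ∀ {w}, v < w → g.Preserves w v k := by
  intro w
  induction w using Nat.strong_induction_on with
  | _ w ih =>
    intro hvw b hb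
    obtain ⟨bv, Q, hbv, hbk, hQ, hA⟩ := hc
    obtain ⟨e, Q', he, hQ', hD⟩ := hg.elected hb (by omega)
    -- `q` both acknowledged `k` in view `v` and voted for the leader of `w`.
    obtain ⟨q, hq, hq'⟩ := exists_mem_of_quorums hQ hQ'
    have hpos := hg.base_pos hb (by omega)
    obtain ⟨hle, b', hb', hiff⟩ := hg.canon_view he
    rw [hb] at hb'
    cases hb'
    have hmatch : ∀ m ≤ b - 1, ∀ e', g.canon e.view m = some e' → g.canon w m = some e' := by
      intro m hm e' he'
      obtain ⟨e'', he''⟩ := hg.canon_defined hb (m := m) (by omega)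
      have := hg.matching he hm he''
      rw [he'] at this
      exact he''.trans this.symm
    have hlt : e.view < w := by
      rcases hle.lt_or_eq with h | h
      · exact h
      · have := hiff.1 h; omega
    rcases (hD q hq').2 v bv k hvw hbv hbk (hA q hq) (fun x h1 h2 => ih x h2 h1) with h | ⟨h, hk⟩
    · obtain ⟨-, bu, hbu, hu⟩ := hg.canon_view (hg.matching he le_rfl he)
      have hbu' := hu.1 rfl
      obtain ⟨hk, hP⟩ := ih e.view hlt h bu hbu
      exact ⟨by omega, fun m hm e' he' => hmatch m (by omega) e' (hP m hm e' he')⟩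
    · subst h
      exact ⟨by omega, fun m hm => hmatch m (hm.trans hk)⟩

theorem Inv.canon_of_known {g : History f α} (hg : g.Inv) {v b n : ℕ} {e : Entry f α}
    (hb : g.base v = some b) (h : g.Known v n e) : g.canon v n = some e := by
  rcases h with h | ⟨u, k, hu, hk, hc, he⟩
  · exact h
  · exact ((hg.preserves hc hu) b hb).2 n hk e he

/-- From the base of an opened view on, announced acknowledgements are genuine ones of that view. -/
theorem Inv.le_acked {g : History f α} (hg : g.Inv) {v b a : ℕ} {q : Replica f}
    (hb : g.base v = some b) (hba : b ≤ a) (h : g.Acknowledged v q a) : a ≤ g.acked v q := by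
  rcases h with h | ⟨u, k, hu, hk, hc⟩
  · exact h
  · have := ((hg.preserves hc hu) b hb).1
    omega

/-- Canonical logs agree up to chosen slots. -/
theorem Inv.canon_eq_of_chosen {g : History f α} (hg : g.Inv) {v v' k k' n : ℕ}
    {c c' : Entry f α} (hc : g.Chosen v k) (hc' : g.Chosen v' k') (hk : n ≤ k) (hk' : n ≤ k')
    (h : g.canon v n = some c) (h' : g.canon v' n = some c') : c' = c := by
  rcases lt_trichotomy v v' with hv | rfl | hv
  · obtain ⟨b, -, hb, -⟩ := hc'
    have := ((hg.preserves hc hv) b hb).2 n hk c h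
    rw [h'] at this
    exact Option.some.inj this
  · rw [h] at h'
    exact (Option.some.inj h').symm
  · obtain ⟨b, -, hb, -⟩ := hc
    have := ((hg.preserves hc' hv) b hb).2 n hk' c' h'
    rw [h] at this
    exact (Option.some.inj this).symm

end History

open History

/-! ### The invariant of a replica -/

/-- The part of the invariant that concerns the log and the indices into it. Below `lastAck` the log
is canonical for the current view; between `lastAck` and `lastAppend` each entry only vouches for
the prefix below it, relative to its own view; above `lastAppend` there are entries of the canonical
log of the current view. -/
structure Local.LogInv (g : History f α) (r : Replica f) (s : Local f α) : Prop where
  commit_le : s.lastCommit ≤ s.lastAck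
  ack_le : s.lastAck ≤ s.lastAppend
  appended : ∀ n ≤ s.lastAppend, ∃ e, s.log n = some e ∧ e.view ≤ s.view
  matching : ∀ m n e e', m ≤ n → n ≤ s.lastAppend → s.log n = some e → s.log m = some e' →
    g.canon e.view m = some e'
  buffered : ∀ m e, s.lastAppend < m → s.log m = some e → g.canon s.view m = some e
  unopened : s.viewBase = none → s.lastAck = s.lastCommit ∧
    ∀ m e, s.lastAppend < m → s.log m = some e → e.view = s.view
  opened : ∀ b, s.viewBase = some b → g.base s.view = some b ∧ s.view ≠ 0 ∧
    (s.lastAppend < b ∨ s.lastAck = s.lastAppend) ∧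
    ∀ m ≤ s.lastAck, ∀ e, s.log m = some e → g.canon s.view m = some e
  committed : ∃ u k, g.Chosen u k ∧ s.lastCommit ≤ k ∧ u ≤ s.view ∧
    (s.viewBase = none → u < s.view ∨ s.view = 0) ∧
    ∀ m ≤ s.lastCommit, ∀ e, s.log m = some e → g.canon u m = some e
  ack_valid : g.Acknowledged s.view r s.lastAck
  acked_valid : ∀ q, g.Acknowledged s.view q (s.acked q)

/-- The part of the invariant that concerns the acknowledgements given by `r`. Slots acknowledged in
a view are held as long as the later views up to the current one preserve them. -/
structure Local.AckInv (g : History f α) (r : Replica f) (s : Local f α) : Prop where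
  acked_le : g.acked s.view r ≤ s.lastAck
  acked_future : ∀ x, s.view < x → g.acked x r = 0
  retained : ∀ x b k, g.base x = some b → b ≤ k → k ≤ g.acked x r →
    (∀ y, x < y → y ≤ s.view → g.Preserves y x k) →
    k ≤ s.lastAppend ∧ ∃ e, s.log k = some e ∧ g.canon x k = some e

/-- The part of the invariant that makes the proposals of a view unique: at the slots owned by `r`,
canonical entries exist only below its `nextPropose`. -/
structure Local.ProposalInv (g : History f α) (r : Replica f) (s : Local f α) : Prop where
  own : ∀ x b n owner e, g.base x = some b → b < n →
    g.canon x b = some ⟨x, Command.viewInit owner⟩ → owner n = r → g.canon x n = some e →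
    x ≤ s.view ∧ (x = s.view → s.viewBase = some b ∧ b ≤ s.lastCommit ∧
      ∀ p, s.nextPropose = some p → n < p)
  next : ∀ p, s.nextPropose = some p → ∃ b owner, s.viewBase = some b ∧
    g.canon s.view b = some ⟨s.view, Command.viewInit owner⟩ ∧ b < p ∧ owner p = r ∧
    b ≤ s.lastCommit

/-- The part of the invariant that concerns elections. A candidate has not changed its log since it
entered its view, and nobody is both leader of and candidate for a view. -/
structure Local.ElectionInv (g : History f α) (r : Replica f) (s : Local f α) : Prop where
  candidate : s.role = Role.candidate → s.viewBase = none ∧ s.view ≠ 0 ∧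
    (∀ m e, s.log m = some e → m ≤ s.lastAppend ∧ e.view < s.view) ∧
    ∀ q ∈ s.votedBy, g.vote s.view q = some r ∧
      g.Dominates s.view q s.lastAppendView s.lastAppend
  request : ∀ w t u, (r, Message.viewChangeRequest w t u) ∈ g.sent → w ≤ s.view ∧
    (w = s.view → s.role = Role.candidate → t = s.lastAppend ∧ u = s.lastAppendView)
  leader : ∀ x b, g.base x = some b → x ≠ 0 → g.leader x = r →
    x ≤ s.view ∧ (x = s.view → s.role ≠ Role.candidate)
  vote : ∀ x c, g.vote x r = some c → x ≤ s.view

/-- The invariant of the replica `r` in the local state `s`, relative to the history `g`. -/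
structure Local.Inv (g : History f α) (r : Replica f) (s : Local f α) : Prop extends
  s.LogInv g r, s.AckInv g r, s.ProposalInv g r, s.ElectionInv g r

/-- Going from `g` to `g'` records no action of the replica `r`: no acknowledgement, no vote, no
candidacy, no leadership, and no proposal at a slot that `r` owns. -/
structure Foreign (r : Replica f) (g g' : History f α) : Prop where
  acked : ∀ x, g'.acked x r = g.acked x r
  own : ∀ {x b n owner e}, g'.base x = some b → b < n →
    g'.canon x b = some ⟨x, Command.viewInit owner⟩ → owner n = r → g'.canon x n = some e →
    g.base x = some b ∧ g.canon x b = some ⟨x, Command.viewInit owner⟩ ∧ g.canon x n = some e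
  request : ∀ {w t u}, (r, Message.viewChangeRequest w t u) ∈ g'.sent →
    (r, Message.viewChangeRequest w t u) ∈ g.sent
  leader : ∀ {x b}, g'.base x = some b → g'.leader x = r →
    g.base x = some b ∧ g.leader x = r
  vote : ∀ {x c}, g'.vote x r = some c → g.vote x r = some c

section Mono

variable {g g' : History f α} {r : Replica f} {s : Local f α} (hx : g.Ext g')
include hx

theorem Local.LogInv.mono (h : s.LogInv g r) : s.LogInv g' r where
  commit_le := h.commit_le
  ack_le := h.ack_le
  appended := h.appended
  matching m n e e' h1 h2 h3 h4 := hx.canon (h.matching m n e e' h1 h2 h3 h4)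
  buffered m e h1 h2 := hx.canon (h.buffered m e h1 h2)
  unopened := h.unopened
  opened b hb := by
    obtain ⟨h1, h2, h3, h4⟩ := h.opened b hb
    exact ⟨hx.base h1, h2, h3, fun m hm e he => hx.canon (h4 m hm e he)⟩
  committed := by
    obtain ⟨u, k, h1, h2, h3, h4, h5⟩ := h.committed
    exact ⟨u, k, h1.mono hx, h2, h3, h4, fun m hm e he => hx.canon (h5 m hm e he)⟩
  ack_valid := h.ack_valid.mono hx
  acked_valid q := (h.acked_valid q).mono hx

theorem Local.AckInv.mono (hg : g.LogInv) (hA : ∀ x, g'.acked x r = g.acked x r)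
    (h : s.AckInv g r) : s.AckInv g' r where
  acked_le := by rw [hA]; exact h.acked_le
  acked_future x hlt := by rw [hA]; exact h.acked_future x hlt
  retained x b k hb hbk hk hP := by
    rw [hA] at hk
    cases hb' : g.base x with
    | none => exact absurd hk (hg.not_le_acked hb' (hx.base_pos hb' hb) hbk)
    | some b' =>
      have := hx.base hb'
      rw [hb] at this
      cases this
      obtain ⟨h1, e, h2, h3⟩ := h.retained x b k hb' hbk hk
        fun y h1 h2 => (hP y h1 h2).of_ext hx hg
      exact ⟨h1, e, h2, hx.canon h3⟩

theorem Local.Inv.mono (hg : g.LogInv) (hf : Foreign r g g') (h : s.Inv g r) : s.Inv g' r where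
  toLogInv := h.toLogInv.mono hx
  toAckInv := h.toAckInv.mono hx hg hf.acked
  own x b n owner e h1 h2 h3 h4 h5 := by
    obtain ⟨k1, k3, k5⟩ := hf.own h1 h2 h3 h4 h5
    exact h.own x b n owner e k1 h2 k3 h4 k5
  next p hp := by
    obtain ⟨b, owner, h1, h2, h3⟩ := h.next p hp
    exact ⟨b, owner, h1, hx.canon h2, h3⟩
  candidate hr := by
    obtain ⟨h1, h2, h3, h4⟩ := h.candidate hr
    exact ⟨h1, h2, h3, fun q hq => ⟨hx.vote (h4 q hq).1, (h4 q hq).2.mono hx hg (h4 q hq).1⟩⟩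
  request w t u hm := h.request w t u (hf.request hm)
  leader x b hb hx0 hl := by
    obtain ⟨h1, h2⟩ := hf.leader hb hl
    exact h.leader x b h1 hx0 h2
  vote x c hv := h.vote x c (hf.vote hv)

theorem Local.ProposalInv.mono (hf : ∀ x, g'.base x = g.base x) (hc : ∀ x, g'.canon x = g.canon x)
    (h : s.ProposalInv g r) : s.ProposalInv g' r where
  own x b n owner e h1 h2 h3 h4 h5 :=
    h.own x b n owner e ((hf x).symm.trans h1) h2 (hc x ▸ h3) h4 (hc x ▸ h5)
  next p hp := by
    obtain ⟨b, owner, h1, h2, h3⟩ := h.next p hp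
    exact ⟨b, owner, h1, hx.canon h2, h3⟩

end Mono

/-! ### Changes of the local state that leave the history as it is -/

section Transitions

variable {g : History f α} {r : Replica f} {s : Local f α}

theorem Local.ElectionInv.congr (h : s.ElectionInv g r) {s' : Local f α} (hv : s'.view = s.view)
    (hr : s'.role ≠ Role.candidate) : s'.ElectionInv g r where
  candidate h' := absurd h' hr
  request w t u hm := by
    rw [hv]; exact ⟨(h.request w t u hm).1, fun _ h' => absurd h' hr⟩
  leader x b hb hx hl := by
    rw [hv]; exact ⟨(h.leader x b hb hx hl).1, fun _ => hr⟩
  vote x c hc := by rw [hv]; exact h.vote x c hc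

theorem Local.ProposalInv.of_unopened (h : s.ProposalInv g r) (hb : s.viewBase = none)
    {s' : Local f α} (hv : s'.view = s.view) (hn : s'.nextPropose = s.nextPropose) :
    s'.ProposalInv g r where
  own x b n owner e h1 h2 h3 h4 h5 := by
    obtain ⟨k1, k2⟩ := h.own x b n owner e h1 h2 h3 h4 h5
    rw [hv]
    refine ⟨k1, fun hxv => ?_⟩
    have := (k2 hxv).1
    rw [hb] at this
    exact absurd this (by simp)
  next p hp := by
    rw [hn] at hp
    obtain ⟨b, _, h1, _⟩ := h.next p hp
    rw [hb] at h1
    exact absurd h1 (by simp)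

theorem Local.Inv.role_ne (h : s.Inv g r) {b : ℕ} (hb : s.viewBase = some b) :
    s.role ≠ Role.candidate := fun hr => by
  have := (h.candidate hr).1
  rw [hb] at this
  exact absurd this (by simp)

theorem Local.Inv.enterView (h : s.Inv g r) {v : ℕ} (hv : s.view < v) {role : Role}
    (hr : role ≠ Role.candidate) (vf : Option (Replica f)) (vb : Finset (Replica f)) :
    (s.enterView v role vf vb).Inv g r where
  commit_le := le_rfl
  ack_le := h.commit_le.trans h.ack_le
  appended n hn := by
    obtain ⟨e, he, hev⟩ := h.appended n hn
    exact ⟨e, (if_pos hn).trans he, hev.trans hv.le⟩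
  matching m n e e' hmn hn he he' := by
    simp only [Local.enterView] at hn he he'
    rw [if_pos hn] at he
    rw [if_pos (hmn.trans hn)] at he'
    exact h.matching m n e e' hmn hn he he'
  buffered m e hm he := by
    simp only [Local.enterView] at hm he
    rw [if_neg (by omega)] at he
    exact absurd he (by simp)
  unopened _ := by
    refine ⟨rfl, fun m e hm he => ?_⟩
    simp only [Local.enterView] at hm he
    rw [if_neg (by omega)] at he
    exact absurd he (by simp)
  opened b hb := absurd hb (by simp [Local.enterView])
  committed := by
    obtain ⟨u, k, h1, h2, h3, h4, h5⟩ := h.committed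
    refine ⟨u, k, h1, h2, h3.trans hv.le, fun _ => .inl (lt_of_le_of_lt h3 hv), fun m hm e he => ?_⟩
    refine h5 m hm e ?_
    simp only [Local.enterView] at he hm
    rwa [if_pos (hm.trans (h.commit_le.trans h.ack_le))] at he
  ack_valid := by
    obtain ⟨u, k, h1, h2, h3, -⟩ := h.committed
    exact .inr ⟨u, k, lt_of_le_of_lt h3 hv, h2, h1⟩
  acked_valid q := .inl (Nat.zero_le _)
  acked_le := by
    simp only [Local.enterView]
    rw [h.acked_future v hv]
    exact Nat.zero_le _
  acked_future x hlt := h.acked_future x (hv.trans hlt)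
  retained x b k hb hbk hk hP := by
    obtain ⟨h1, e, h2, h3⟩ := h.retained x b k hb hbk hk fun y h1 h2 => hP y h1 (h2.trans hv.le)
    exact ⟨h1, e, (if_pos h1).trans h2, h3⟩
  own x b n owner e h1 h2 h3 h4 h5 := by
    have := (h.own x b n owner e h1 h2 h3 h4 h5).1
    refine ⟨this.trans hv.le, fun hxv => ?_⟩
    simp only [Local.enterView] at hxv
    omega
  next p hp := absurd hp (by simp [Local.enterView])
  candidate h' := absurd h' hr
  request w t u hm := ⟨(h.request w t u hm).1.trans hv.le, fun _ h' => absurd h' hr⟩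
  leader x b hb hx hl := ⟨(h.leader x b hb hx hl).1.trans hv.le, fun _ => hr⟩
  vote x c hc := (h.vote x c hc).trans hv.le

/-- When a replica leaves for a higher view `w`, its log is at least as up-to-date as all it has
acknowledged. -/
theorem Local.Inv.dominates (hg : g.LogInv) (h : s.Inv g r) {w : ℕ} (hw : s.view < w) :
    g.Dominates w r s.lastAppendView s.lastAppend := by
  intro v b k hvw hb hbk hk hP
  have hv : v ≤ s.view := by
    by_contra! hv
    have := hg.base_pos hb (by omega)
    rw [h.acked_future v hv] at hk
    omega
  obtain ⟨hkt, ek, hek, hck⟩ := h.retained v b k hb hbk hk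
    fun y h1 h2 => hP y h1 (lt_of_le_of_lt h2 hw)
  obtain ⟨e, he, -⟩ := h.appended _ le_rfl
  have hu : s.lastAppendView = e.view := by simp [Local.lastAppendView, he]
  obtain ⟨-, b', hb', hiff⟩ := hg.canon_view hck
  rw [hb] at hb'
  cases hb'
  have := (hg.canon_view (h.matching k _ e ek hkt le_rfl he hek)).1
  rw [hiff.2 hbk] at this
  rw [hu]
  omega

theorem Local.Inv.learnViewInit (hg : g.Inv) (h : s.Inv g r) (hs : s.viewBase = none) {b : ℕ}
    {e : Entry f α} (hc : g.canon s.view b = some e) (hev : e.view = s.view)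
    (hvi : e.IsViewInit) : (s.learnViewInit b e).Inv g r := by
  obtain ⟨hb, hv0⟩ := hg.viewInit hc hev hvi
  obtain ⟨u, k, h1, h2, h3, h4, h5⟩ := h.committed
  -- The committed slots lie below `b`, so that the truncation at `b` does not touch them.
  have huv : u < s.view := (h4 hs).resolve_right hv0
  obtain ⟨hkb, hP⟩ := hg.preserves h1 huv b hb
  obtain ⟨hack, hbuf⟩ := h.unopened hs
  have hca := h.commit_le.trans h.ack_le
  have hlow : ∀ m, m < b → (s.learnViewInit b e).log m = s.log m := fun m hm => if_pos hm
  have hmid : (s.learnViewInit b e).log b = some e := by simp [Local.learnViewInit]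
  have hhigh : ∀ m, b < m → (s.learnViewInit b e).log m = none := fun m hm => by
    simp only [Local.learnViewInit]
    rw [if_neg (by omega), if_neg (by omega)]
  have happ : (s.learnViewInit b e).lastAppend = min s.lastAppend (b - 1) := rfl
  refine { toProposalInv := h.toProposalInv.of_unopened hs rfl rfl
           toElectionInv := h.toElectionInv.congr rfl (by simp [Local.learnViewInit])
           commit_le := ?_
           ack_le := ?_
           appended := ?_
           matching := ?_
           buffered := ?_
           unopened := ?_
           opened := ?_
           committed := ?_
           ack_valid := ?_
           acked_valid := ?_
           acked_le := ?_
           acked_future := ?_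
           retained := ?_ }
  · exact h.commit_le
  · rw [happ]
    show s.lastAck ≤ _
    omega
  · intro n hn
    rw [happ] at hn
    rw [hlow n (by omega)]
    exact h.appended n (by omega)
  · intro m n e₁ e₂ hmn hn he₁ he₂
    rw [happ] at hn
    rw [hlow _ (by omega)] at he₁ he₂
    exact h.matching m n e₁ e₂ hmn (by omega) he₁ he₂
  · intro m e' hm he'
    rw [happ] at hm
    show g.canon s.view m = some e'
    rcases lt_trichotomy m b with hmb | rfl | hmb
    · rw [hlow m hmb] at he'
      exact h.buffered m e' (by omega) he'
    · rw [hmid] at he'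
      cases he'
      exact hc
    · rw [hhigh m hmb] at he'
      exact absurd he' (by simp)
  · intro h'
    exact absurd h' (by simp [Local.learnViewInit])
  · intro b' hb'
    have : b = b' := by simpa [Local.learnViewInit] using hb'
    subst this
    refine ⟨hb, hv0, .inl ?_, fun m hm e' he' => ?_⟩
    · have := hg.base_pos hb hv0
      rw [happ]
      omega
    · have hm' : m ≤ s.lastAck := hm
      rw [hlow m (by omega)] at he'
      exact hP m (by omega) e' (h5 m (by omega) e' he')
  · refine ⟨u, k, h1, h2, h3, fun _ => h4 hs, fun m hm e' he' => ?_⟩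
    have hm' : m ≤ s.lastCommit := hm
    rw [hlow m (by omega)] at he'
    exact h5 m hm' e' he'
  · exact h.ack_valid
  · exact h.acked_valid
  · exact h.acked_le
  · exact h.acked_future
  · intro x bx k' hbx hbk hk hPr
    have hPr' : ∀ y, x < y → y ≤ s.view → g.Preserves y x k' := hPr
    obtain ⟨k1, ek, k2, k3⟩ := h.retained x bx k' hbx hbk hk hPr'
    have hkb' : k' < b := by
      rcases lt_trichotomy x s.view with hx | rfl | hx
      · exact (hPr' _ hx le_rfl b hb).1
      · have := h.acked_le
        omega
      · have := h.acked_future x hx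
        omega
    rw [hlow k' hkb']
    exact ⟨by rw [happ]; omega, ek, k2, k3⟩

theorem Local.Inv.buffer (h : s.Inv g r) (hr : s.role ≠ Role.candidate) {n : ℕ}
    {e : Entry f α} (hc : g.canon s.view n = some e)
    (hev : s.viewBase = none → e.view = s.view) : (s.buffer n e).Inv g r := by
  unfold Local.buffer
  split_ifs with hif
  swap
  · exact h
  obtain ⟨hn, hnone⟩ := hif
  have hne : ∀ m, m ≤ s.lastAppend → Function.update s.log n (some e) m = s.log m :=
    fun m hm => Function.update_of_ne (by omega) _ _
  have hca := h.commit_le.trans h.ack_le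
  have hbuf : ∀ m e', s.lastAppend < m → Function.update s.log n (some e) m = some e' →
      s.log m = some e' ∨ (m = n ∧ e' = e) := by
    intro m e' hm he'
    by_cases hmn : m = n
    · subst hmn
      rw [Function.update_self] at he'
      exact .inr ⟨rfl, (Option.some.inj he').symm⟩
    · rw [Function.update_of_ne hmn] at he'
      exact .inl he'
  refine { toProposalInv := ⟨h.own, h.next⟩
           toElectionInv := h.toElectionInv.congr rfl hr
           commit_le := h.commit_le
           ack_le := h.ack_le
           ack_valid := h.ack_valid
           acked_valid := h.acked_valid
           acked_le := h.acked_le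
           acked_future := h.acked_future
           appended := ?_
           matching := ?_
           buffered := ?_
           unopened := ?_
           opened := ?_
           committed := ?_
           retained := ?_ }
  · intro m hm
    obtain ⟨e', he', hv⟩ := h.appended m hm
    exact ⟨e', (hne m hm).trans he', hv⟩
  · intro m n' e₁ e₂ hmn hn' he₁ he₂
    exact h.matching m n' e₁ e₂ hmn hn' ((hne _ hn').symm.trans he₁)
      ((hne _ (hmn.trans hn')).symm.trans he₂)
  · intro m e' hm he'
    rcases hbuf m e' hm he' with h' | ⟨rfl, rfl⟩
    · exact h.buffered m e' hm h'
    · exact hc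
  · intro hs
    refine ⟨(h.unopened hs).1, fun m e' hm he' => ?_⟩
    rcases hbuf m e' hm he' with h' | ⟨rfl, rfl⟩
    · exact (h.unopened hs).2 m e' hm h'
    · exact hev hs
  · intro b hb
    obtain ⟨h1, h2, h3, h4⟩ := h.opened b hb
    exact ⟨h1, h2, h3, fun m hm e' he' => h4 m hm e' ((hne m (hm.trans h.ack_le)).symm.trans he')⟩
  · obtain ⟨u, k, h1, h2, h3, h4, h5⟩ := h.committed
    exact ⟨u, k, h1, h2, h3, h4,
      fun m hm e' he' => h5 m hm e' ((hne m (le_trans hm hca)).symm.trans he')⟩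
  · intro x b k hb hbk hk hP
    obtain ⟨h1, e', h2, h3⟩ := h.retained x b k hb hbk hk hP
    exact ⟨h1, e', (hne k h1).trans h2, h3⟩

theorem Local.Inv.receiveAck (h : s.Inv g r) {q : Replica f} {a : ℕ}
    (ha : g.Acknowledged s.view q a) : (s.receiveAck q a).Inv g r :=
  { h with
    acked_valid := fun q' => by
      by_cases hq : q' = q
      · subst hq
        simpa [Local.receiveAck] using ha
      · simpa [Local.receiveAck, hq] using h.acked_valid q'
    toProposalInv := ⟨h.own, h.next⟩
    toElectionInv := ⟨h.candidate, h.request, h.leader, h.vote⟩ }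

theorem Local.Inv.deliver (hg : g.Inv) (h : s.Inv g r) (hr : s.role ≠ Role.candidate) {n : ℕ}
    {e : Entry f α} (hc : g.canon s.view n = some e) (hev : e.view = s.view) :
    (s.deliver n e).Inv g r := by
  unfold Local.deliver
  split_ifs with hif
  · exact h.learnViewInit hg hif.2 hc hev hif.1
  · exact h.buffer hr hc fun _ => hev

theorem Local.Inv.followProposal (h : s.Inv g r) {v : ℕ} (hv : s.view ≤ v) :
    (s.followProposal v).Inv g r ∧ (s.followProposal v).view = v ∧
      (s.followProposal v).role ≠ Role.candidate := by
  unfold Local.followProposal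
  split_ifs with hlt
  · exact ⟨h.enterView hlt (by simp) _ _, rfl, by simp [Local.enterView]⟩
  · have hv' : s.view = v := by omega
    cases hr : s.role with
    | candidate =>
      refine ⟨?_, hv', by simp⟩
      exact { h with
              toProposalInv := ⟨h.own, h.next⟩
              toElectionInv := h.toElectionInv.congr rfl (by simp) }
    | initiator => exact ⟨h, hv', by simp [hr]⟩
    | follower => exact ⟨h, hv', by simp [hr]⟩

theorem deliver_view (n : ℕ) (e : Entry f α) : (s.deliver n e).view = s.view := by
  unfold Local.deliver Local.buffer
  split_ifs <;> rfl

theorem Local.Inv.replaceFrom (hg : g.Inv) (h : s.Inv g r) {b n : ℕ} (hb : s.viewBase = some b)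
    {e : Entry f α} (hc : g.canon s.view n = some e) (hn : s.lastAck < n) (hn' : n ≤ s.lastAppend)
    (hne : (s.log n).map Entry.view ≠ some e.view) : (s.replaceFrom n e).Inv g r := by
  have hlow : ∀ m, m < n → (s.replaceFrom n e).log m = s.log m := fun m hm => by
    simp only [Local.replaceFrom]
    rw [if_neg (by omega), if_neg (by omega)]
  have hmid : (s.replaceFrom n e).log n = some e := by simp [Local.replaceFrom]
  have happ : (s.replaceFrom n e).lastAppend = n - 1 := rfl
  have hcl := h.commit_le
  refine { toProposalInv := ⟨h.own, h.next⟩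
           toElectionInv := h.toElectionInv.congr rfl (h.role_ne hb)
           commit_le := h.commit_le
           ack_valid := h.ack_valid
           acked_valid := h.acked_valid
           acked_le := h.acked_le
           acked_future := h.acked_future
           ack_le := ?_
           appended := ?_
           matching := ?_
           buffered := ?_
           unopened := ?_
           opened := ?_
           committed := ?_
           retained := ?_ }
  · rw [happ]
    show s.lastAck ≤ _
    omega
  · intro m hm
    rw [happ] at hm
    rw [hlow m (by omega)]
    exact h.appended m (by omega)
  · intro m n' e₁ e₂ hmn hn'' he₁ he₂
    rw [happ] at hn''
    rw [hlow _ (by omega)] at he₁ he₂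
    exact h.matching m n' e₁ e₂ hmn (by omega) he₁ he₂
  · intro m e' hm he'
    rw [happ] at hm
    show g.canon s.view m = some e'
    by_cases hmn : m = n
    · subst hmn
      rw [hmid] at he'
      cases he'
      exact hc
    · simp only [Local.replaceFrom] at he'
      rw [if_neg hmn] at he'
      split_ifs at he' with hif
      exact h.buffered m e' (by omega) he'
  · intro hs
    exact absurd (hb.symm.trans hs) (by simp)
  · intro b' hb'
    obtain ⟨h1, h2, h3, h4⟩ := h.opened b' hb'
    refine ⟨h1, h2, .inl ?_, fun m hm e' he' => ?_⟩
    · rw [happ]; omega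
    · have hm' : m ≤ s.lastAck := hm
      rw [hlow m (by omega)] at he'
      exact h4 m hm' e' he'
  · obtain ⟨u, k, h1, h2, h3, h4, h5⟩ := h.committed
    refine ⟨u, k, h1, h2, h3, h4, fun m hm e' he' => ?_⟩
    have hm' : m ≤ s.lastCommit := hm
    rw [hlow m (by omega)] at he'
    exact h5 m hm' e' he'
  · intro x bx k hbx hbk hk hP
    have hP' : ∀ y, x < y → y ≤ s.view → g.Preserves y x k := hP
    obtain ⟨h1, ek, h2, h3⟩ := h.retained x bx k hbx hbk hk hP'
    -- If the discarded part held a retained slot `k ≥ n`, the old entry at `n` would be the one of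
    -- `canon x`, hence of `canon s.view`, which is `e`; but their views differ.
    have hkn : k < n := by
      rcases lt_trichotomy x s.view with hx | rfl | hx
      · by_contra! hnk
        obtain ⟨-, hP⟩ := hP' _ hx le_rfl b (h.opened b hb).1
        obtain ⟨-, bx', hbx', hiff⟩ := hg.canon_view h3
        rw [hbx] at hbx'
        cases hbx'
        obtain ⟨en, hen, -⟩ := h.appended n hn'
        have h4 := h.matching n k ek en hnk h1 h2 hen
        rw [hiff.2 hbk] at h4
        have h5 := hP n hnk en h4
        rw [hc] at h5
        cases h5
        exact hne (by rw [hen]; rfl)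
      · have := h.acked_le
        omega
      · have := h.acked_future x hx
        omega
    rw [hlow k hkn]
    exact ⟨by rw [happ]; omega, ek, h2, h3⟩

theorem Local.Inv.canon_of_scheme (hg : g.Inv) (h : s.Inv g r) {b : ℕ} (hb : s.viewBase = some b)
    {owner : ℕ → Replica f} (hs : s.scheme = some owner) :
    g.canon s.view b = some ⟨s.view, Command.viewInit owner⟩ := by
  obtain ⟨h1, h2, h3, h4⟩ := h.opened b hb
  have hlog : ∃ u, s.log b = some ⟨u, Command.viewInit owner⟩ := by
    simp only [Local.scheme, hb] at hs
    split at hs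
    · rename_i u owner' he
      exact ⟨u, by rw [he]; simpa using hs⟩
    · exact absurd hs (by simp)
  obtain ⟨u, hu⟩ := hlog
  have hc : g.canon s.view b = some ⟨u, Command.viewInit owner⟩ := by
    by_cases hlt : s.lastAppend < b
    · exact h.buffered b _ hlt hu
    · exact h4 b (by omega) _ hu
  obtain ⟨-, b', hb', hiff⟩ := hg.canon_view hc
  rw [h1] at hb'
  cases hb'
  have : u = s.view := hiff.2 le_rfl
  rwa [this] at hc

theorem Local.Inv.commitUpTo (hg : g.Inv) (h : s.Inv g r) {b k : ℕ} (hb : s.viewBase = some b)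
    (hbk : b ≤ k) (hnew : s.lastCommit < k) (hk : k ≤ s.lastAck)
    (hq : f + 1 ≤ (Finset.univ.filter (fun q => q = r ∨ k ≤ s.acked q)).card) :
    (s.commitUpTo r b k).Inv g r := by
  obtain ⟨h1, h2, h3, h4⟩ := h.opened b hb
  refine { ack_le := h.ack_le
           appended := h.appended
           matching := h.matching
           buffered := h.buffered
           opened := h.opened
           unopened := fun hs => absurd (hb.symm.trans hs) (by simp)
           ack_valid := h.ack_valid
           acked_valid := h.acked_valid
           toAckInv := ⟨h.acked_le, h.acked_future, h.retained⟩
           toElectionInv := h.toElectionInv.congr rfl (h.role_ne hb)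
           commit_le := hk
           committed := ?_
           own := ?_
           next := ?_ }
  · refine ⟨s.view, k, ⟨b, _, h1, hbk, hq, fun q hq => ?_⟩, le_rfl, le_rfl, ?_, ?_⟩
    · rcases (Finset.mem_filter.1 hq).2 with rfl | hq
      · exact hk.trans (hg.le_acked h1 (hbk.trans hk) h.ack_valid)
      · exact hq.trans (hg.le_acked h1 (hbk.trans hq) (h.acked_valid q))
    · exact fun hs => absurd (hb.symm.trans hs) (by simp)
    · exact fun m hm e he => h4 m (le_trans hm hk) e he
  · intro x b' n owner e k1 k2 k3 k4 k5
    obtain ⟨k6, k7⟩ := h.own x b' n owner e k1 k2 k3 k4 k5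
    refine ⟨k6, fun hx => ?_⟩
    obtain ⟨k8, k9, k10⟩ := k7 hx
    refine ⟨k8, k9.trans hnew.le, fun p hp => k10 p ?_⟩
    rw [hb] at k8
    cases k8
    simp only [Local.commitUpTo] at hp
    rwa [if_neg (by omega)] at hp
  · intro p hp
    simp only [Local.commitUpTo] at hp
    split_ifs at hp with hif
    · cases hs : s.scheme with
      | none => simp [hs] at hp
      | some owner =>
        simp only [hs, Option.bind_some, nextAssigned] at hp
        split_ifs at hp with hex
        cases hp
        classical
        exact ⟨b, owner, hb, h.canon_of_scheme hg hb hs, (Nat.find_spec hex).1, (Nat.find_spec hex).2, hbk⟩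
    · obtain ⟨b', owner, k1, k2, k3, k4, k5⟩ := h.next p hp
      exact ⟨b', owner, k1, k2, k3, k4, k5.trans hnew.le⟩

end Transitions

/-! ### Extensions of the history -/

namespace History

/-- Record that `r` has issued the messages in `out`. -/
def send (g : History f α) (r : Replica f) (out : Set (Message f α)) : History f α :=
  { g with sent := g.sent ∪ {p | p.1 = r ∧ p.2 ∈ out} }

/-- Record that `r` has acknowledged slot `k` in view `v`. -/
def setAcked (g : History f α) (v : ℕ) (r : Replica f) (k : ℕ) : History f α :=
  { g with acked := fun x q => if x = v ∧ q = r then k else g.acked x q }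

/-- Record that `r` has voted for `c` in view `v`. -/
def setVote (g : History f α) (v : ℕ) (r c : Replica f) : History f α :=
  { g with vote := fun x q => if x = v ∧ q = r then some c else g.vote x q }

/-- Record that `e` has been proposed at slot `n` in view `v`. -/
def extend (g : History f α) (v n : ℕ) (e : Entry f α) : History f α :=
  { g with canon := fun x m => if x = v ∧ m = n then some e else g.canon x m }

/-- Record that `r` has opened the view `v` at slot `b`, having then the log `log` and acknowledging
all of it. -/
def openView (g : History f α) (v b : ℕ) (r : Replica f) (log : ℕ → Option (Entry f α)) :
    History f α :=
  { g with
    base := fun x => if x = v then some b else g.base x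
    leader := fun x => if x = v then r else g.leader x
    canon := fun x => if x = v then log else g.canon x
    acked := fun x q => if x = v ∧ q = r then b else g.acked x q }

variable {g : History f α} {r : Replica f} {s : Local f α}

theorem ext_send (out : Set (Message f α)) : g.Ext (g.send r out) where
  base := id
  leader _ := rfl
  canon := id
  acked _ _ := le_rfl
  vote := id
  sent := Set.subset_union_left
  frozen _ _ := rfl
  base_pos h h' := by simp_all [send]

theorem Inv.send (hg : g.Inv) {out : Set (Message f α)} (hm : ∀ m ∈ out, g.MsgValid r m) :
    (g.send r out).Inv where
  base_zero := hg.base_zero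
  canon_view := hg.canon_view
  canon_defined := hg.canon_defined
  base_pos := hg.base_pos
  viewInit := hg.viewInit
  matching := hg.matching
  acked_none := hg.acked_none
  elected hb hw := (hg.elected hb hw).mono (ext_send out) hg.toLogInv hb
  msgs := by
    rintro q m (h | ⟨rfl, h⟩)
    · exact (hg.msgs h).mono (ext_send out) hg.toLogInv
    · exact (hm m h).mono (ext_send out) hg.toLogInv

theorem foreign_send {q : Replica f} {out : Set (Message f α)}
    (h : q = r → ∀ w t u, Message.viewChangeRequest w t u ∉ out) : Foreign q g (g.send r out) where
  acked _ := rfl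
  own h1 _ h3 _ h5 := ⟨h1, h3, h5⟩
  request := by
    rintro w t u (hm | ⟨rfl, hm⟩)
    · exact hm
    · exact absurd hm (h rfl w t u)
  leader h h' := ⟨h, h'⟩
  vote := id

theorem ext_setAcked {v k : ℕ} (hk : g.acked v r ≤ k) (hv : ∀ x c, g.vote x r = some c → x ≤ v) :
    g.Ext (g.setAcked v r k) where
  base := id
  leader _ := rfl
  canon := id
  acked x q := by
    simp only [setAcked]
    split_ifs with h
    · rw [h.1, h.2]; exact hk
    · exact le_rfl
  vote := id
  sent := subset_rfl
  frozen {w q c x} hw hlt := by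
    refine if_neg ?_
    rintro ⟨rfl, rfl⟩
    have := hv w c hw
    omega
  base_pos h h' := by simp_all [setAcked]

theorem Inv.setAcked (hg : g.Inv) {v k b : ℕ} (hb : g.base v = some b)
    (hx : g.Ext (g.setAcked v r k)) : (g.setAcked v r k).Inv where
  base_zero := hg.base_zero
  canon_view := hg.canon_view
  canon_defined := hg.canon_defined
  base_pos := hg.base_pos
  viewInit := hg.viewInit
  matching := hg.matching
  acked_none {x} q h := by
    refine (if_neg ?_).trans (hg.acked_none q h)
    rintro ⟨rfl, rfl⟩
    exact absurd (hb.symm.trans h) (by simp)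
  elected hb hw := (hg.elected hb hw).mono hx hg.toLogInv hb
  msgs h := (hg.msgs h).mono hx hg.toLogInv

theorem foreign_setAcked {v k : ℕ} {q : Replica f} (hq : q ≠ r) :
    Foreign q g (g.setAcked v r k) where
  acked _ := if_neg fun h => hq h.2
  own h1 _ h3 _ h5 := ⟨h1, h3, h5⟩
  request := id
  leader h h' := ⟨h, h'⟩
  vote := id

theorem ext_setVote {v : ℕ} {c : Replica f} (hv : g.vote v r = none) :
    g.Ext (g.setVote v r c) where
  base := id
  leader _ := rfl
  canon := id
  acked _ _ := le_rfl
  vote {x q c'} h := by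
    refine (if_neg ?_).trans h
    rintro ⟨rfl, rfl⟩
    exact absurd (hv.symm.trans h) (by simp)
  sent := subset_rfl
  frozen _ _ := rfl
  base_pos h h' := by simp_all [setVote]

theorem Inv.setVote (hg : g.Inv) {v : ℕ} {c : Replica f} (hx : g.Ext (g.setVote v r c)) :
    (g.setVote v r c).Inv where
  base_zero := hg.base_zero
  canon_view := hg.canon_view
  canon_defined := hg.canon_defined
  base_pos := hg.base_pos
  viewInit := hg.viewInit
  matching := hg.matching
  acked_none := hg.acked_none
  elected hb hw := (hg.elected hb hw).mono hx hg.toLogInv hb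
  msgs h := (hg.msgs h).mono hx hg.toLogInv

theorem foreign_setVote {v : ℕ} {c q : Replica f} (hq : q ≠ r) :
    Foreign q g (g.setVote v r c) where
  acked _ := rfl
  own h1 _ h3 _ h5 := ⟨h1, h3, h5⟩
  request := id
  leader h h' := ⟨h, h'⟩
  vote h := (if_neg fun h' => hq h'.2).symm.trans h

theorem ext_extend {v n : ℕ} {e : Entry f α} (hn : g.canon v n = none) :
    g.Ext (g.extend v n e) where
  base := id
  leader _ := rfl
  canon {x m e'} h := by
    refine (if_neg ?_).trans h
    rintro ⟨rfl, rfl⟩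
    exact absurd (hn.symm.trans h) (by simp)
  acked _ _ := le_rfl
  vote := id
  sent := subset_rfl
  frozen _ _ := rfl
  base_pos h h' := by simp_all [extend]

theorem extend_canon {v n x m : ℕ} {e e' : Entry f α} (h : (g.extend v n e).canon x m = some e') :
    g.canon x m = some e' ∨ (x = v ∧ m = n ∧ e' = e) := by
  simp only [extend] at h
  split_ifs at h with hif
  · exact .inr ⟨hif.1, hif.2, (Option.some.inj h).symm⟩
  · exact .inl h

theorem Inv.extend (hg : g.Inv) {v n b : ℕ} {e : Entry f α} (hb : g.base v = some b)
    (hbn : b < n) (hn : g.canon v n = none) (hev : e.view = v) (hvi : ¬ e.IsViewInit) :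
    (g.extend v n e).Inv where
  base_zero := hg.base_zero
  canon_view h := by
    rcases extend_canon h with h | ⟨rfl, rfl, rfl⟩
    · exact hg.canon_view h
    · exact ⟨hev.le, b, hb, iff_of_true hev hbn.le⟩
  canon_defined hb hm := by
    obtain ⟨e, he⟩ := hg.canon_defined hb hm
    exact ⟨e, (ext_extend hn).canon he⟩
  base_pos := hg.base_pos
  viewInit h hv hi := by
    rcases extend_canon h with h | ⟨rfl, rfl, rfl⟩
    · exact hg.viewInit h hv hi
    · exact absurd hi hvi
  matching {x i m e₁ e₂} h hm h' := by
    -- Only entries below the base say something about other views, and these are not affected.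
    by_cases hx : e₁.view = x
    · rwa [hx]
    rcases extend_canon h with h₁ | ⟨rfl, rfl, rfl⟩
    · rcases extend_canon h' with h₂ | ⟨rfl, rfl, rfl⟩
      · exact (ext_extend hn).canon (hg.matching h₁ hm h₂)
      · obtain ⟨-, b', hb', hiff⟩ := hg.canon_view h₁
        rw [hb] at hb'
        cases hb'
        exact absurd (hiff.2 (by omega)) hx
    · exact absurd hev hx
  acked_none := hg.acked_none
  elected hb hw := (hg.elected hb hw).mono (ext_extend hn) hg.toLogInv hb
  msgs h := (hg.msgs h).mono (ext_extend hn) hg.toLogInv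

end History

theorem Foreign.trans {q : Replica f} {g₁ g₂ g₃ : History f α} (h : Foreign q g₁ g₂)
    (h' : Foreign q g₂ g₃) : Foreign q g₁ g₃ where
  acked x := (h'.acked x).trans (h.acked x)
  own h1 h2 h3 h4 h5 := by
    obtain ⟨k1, k3, k5⟩ := h'.own h1 h2 h3 h4 h5
    exact h.own k1 h2 k3 h4 k5
  request hm := h.request (h'.request hm)
  leader h1 h2 := by
    obtain ⟨k1, k2⟩ := h'.leader h1 h2
    exact h.leader k1 k2
  vote hv := h.vote (h'.vote hv)

theorem Foreign.refl (q : Replica f) (g : History f α) : Foreign q g g :=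
  ⟨fun _ => rfl, fun h1 _ h3 _ h5 => ⟨h1, h3, h5⟩, id, fun h h' => ⟨h, h'⟩, id⟩

/-! ### Local steps -/

/-- Some extension of `g`, foreign to all replicas but `r`, accounts for `r` having moved to the local
state `s'` and having issued the messages in `out`. -/
def Explains (g : History f α) (r : Replica f) (s' : Local f α) (out : Set (Message f α)) : Prop :=
  ∃ g', g.Ext g' ∧ g'.Inv ∧ s'.Inv g' r ∧ (∀ m ∈ out, (r, m) ∈ g'.sent) ∧
    ∀ q ≠ r, Foreign q g g'

section Steps

variable {g g' : History f α} {r : Replica f} {s s' : Local f α} {out : Set (Message f α)}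

theorem Explains.of_send (hx : g.Ext g') (hg : g'.Inv) (hs : s'.Inv g' r)
    (hf : ∀ q ≠ r, Foreign q g g') (hm : ∀ m ∈ out, g'.MsgValid r m)
    (hr : ∀ w t u, Message.viewChangeRequest w t u ∉ out) : Explains g r s' out :=
  ⟨g'.send r out, hx.trans (ext_send out), hg.send hm,
    hs.mono (ext_send out) hg.toLogInv (foreign_send fun _ => hr), fun _ h => .inr ⟨rfl, h⟩,
    fun q hq => (hf q hq).trans (foreign_send fun h => absurd h hq)⟩

theorem Explains.of_same (hg : g.Inv) (hs : s'.Inv g r) : Explains g r s' ∅ :=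
  .of_send (.refl g) hg hs (fun q _ => .refl q g) (by simp) (by simp)

theorem Explains.of_msg (hg : g.Inv) (hs : s'.Inv g r) {m : Message f α} (hm : g.MsgValid r m)
    (hr : ∀ w t u, m ≠ .viewChangeRequest w t u) : Explains g r s' {m} :=
  .of_send (.refl g) hg hs (fun q _ => .refl q g) (by simpa using hm)
    (fun w t u h => hr w t u (Set.mem_singleton_iff.1 h).symm)

theorem Local.Inv.startElection (hg : g.Inv) (h : s.Inv g r) {v : ℕ} (hv : s.view < v) :
    Explains g r (s.enterView v Role.candidate (some r) {r})
      {Message.viewChangeRequest v s.lastAppend s.lastAppendView} := by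
  have hvote : g.vote v r = none := by
    cases hc : g.vote v r with
    | none => rfl
    | some c => have := h.vote v c hc; omega
  have hx : g.Ext (g.setVote v r r) := ext_setVote hvote
  have hlav : (s.enterView v Role.candidate (some r) {r}).lastAppendView = s.lastAppendView := by
    simp [Local.lastAppendView, Local.enterView]
  have hxx := hx.trans (ext_send (r := r)
    {Message.viewChangeRequest v s.lastAppend s.lastAppendView})
  -- Apart from `Local.ElectionInv`, the invariant does not depend on the role.
  have h' := h.enterView hv (role := .follower) (by simp) (some r) {r}
  refine ⟨_, hxx, (hg.setVote hx).send (by simp [MsgValid]), ?_, fun _ h => .inr ⟨rfl, h⟩,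
    fun q hq => (foreign_setVote hq).trans (foreign_send fun h => absurd h hq)⟩
  have hL := h'.toLogInv.mono hxx
  have hA := h'.toAckInv.mono hxx hg.toLogInv fun _ => rfl
  have hP := h'.toProposalInv.mono hxx (fun _ => rfl) fun _ => rfl
  refine { toLogInv := ⟨hL.1, hL.2, hL.3, hL.4, hL.5, hL.6, hL.7, hL.8, hL.9, hL.10⟩
           toAckInv := ⟨hA.1, hA.2, hA.3⟩
           toProposalInv := ⟨hP.1, hP.2⟩
           candidate := fun _ => ⟨rfl, ?_, ?_, ?_⟩
           request := ?_
           leader := ?_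
           vote := ?_ }
  · show v ≠ 0
    omega
  · intro m e he
    simp only [Local.enterView] at he ⊢
    split_ifs at he with hm
    refine ⟨hm, ?_⟩
    obtain ⟨e', he', hle⟩ := h.appended m hm
    rw [he] at he'
    cases he'
    omega
  · intro q hq
    have : q = r := by simpa [Local.enterView] using hq
    subst this
    have hv1 : (g.setVote v q q).vote v q = some q := by simp [History.setVote]
    refine ⟨hv1, ?_⟩
    rw [hlav]
    exact h.dominates hg.toLogInv hv
  · rintro w t u (hm | ⟨-, hm⟩)
    · have := (h.request w t u hm).1
      refine ⟨this.trans hv.le, fun hw => ?_⟩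
      simp only [Local.enterView] at hw
      omega
    · cases hm
      exact ⟨le_rfl, fun _ _ => ⟨rfl, hlav.symm⟩⟩
  · intro x b hb hx0 hl
    have := (h.leader x b hb hx0 hl).1
    refine ⟨this.trans hv.le, fun hw => ?_⟩
    simp only [Local.enterView] at hw
    omega
  · intro x c hc
    simp only [History.send, History.setVote] at hc
    split_ifs at hc with hif
    · exact hif.1.le
    · exact (h.vote x c hc).trans hv.le

theorem Local.Inv.castVote (hg : g.Inv) (h : s.Inv g r) {v n w : ℕ} {c : Replica f}
    (hv : s.view < v) (hm : (c, Message.viewChangeRequest v n w) ∈ g.sent)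
    (hlog : AtLeastAsUpToDate w n s.lastAppendView s.lastAppend) :
    Explains g r (s.enterView v Role.follower (some c) ∅) {Message.viewChangeReply v c} := by
  have hvote : g.vote v r = none := by
    cases hc : g.vote v r with
    | none => rfl
    | some c => have := h.vote v c hc; omega
  have hx : g.Ext (g.setVote v r c) := ext_setVote hvote
  have h' := h.enterView hv (role := .follower) (by simp) (some c) ∅
  refine .of_send hx (hg.setVote hx) ?_ (fun q hq => foreign_setVote hq) ?_ (by simp)
  · refine { toLogInv := h'.toLogInv.mono hx
             toAckInv := h'.toAckInv.mono hx hg.toLogInv fun _ => rfl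
             toProposalInv := h'.toProposalInv.mono hx (fun _ => rfl) fun _ => rfl
             candidate := fun hr => absurd hr (by simp [Local.enterView])
             request := h'.request
             leader := h'.leader
             vote := ?_ }
    intro x c' hc
    simp only [History.setVote] at hc
    split_ifs at hc with hif
    · exact hif.1.le
    · exact (h.vote x c' hc).trans hv.le
  · intro m hm'
    cases hm'
    refine ⟨by simp [History.setVote], n, w, hm, ?_⟩
    intro x b k hxv hb hbk hk hP
    have := h.dominates hg.toLogInv hv x b k hxv hb hbk hk hP
    unfold AtLeastAsUpToDate at hlog
    omega

theorem Local.Inv.receiveVote (hg : g.Inv) (h : s.Inv g r) {q : Replica f}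
    (hm : (q, Message.viewChangeReply s.view r) ∈ g.sent) (hr : s.role = Role.candidate) :
    Local.Inv g r { s with votedBy := insert q s.votedBy } := by
  refine { h with
           toProposalInv := ⟨h.own, h.next⟩
           toElectionInv := ⟨fun _ => ?_, h.request, h.leader, h.vote⟩ }
  obtain ⟨h1, h2, h3, h4⟩ := h.candidate hr
  refine ⟨h1, h2, h3, fun q' hq' => ?_⟩
  rcases Finset.mem_insert.1 hq' with rfl | hq'
  · obtain ⟨k1, t, u, k2, k3⟩ := hg.msgs hm
    obtain ⟨rfl, rfl⟩ := (h.request _ _ _ k2).2 rfl hr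
    exact ⟨k1, k3⟩
  · exact h4 q' hq'

/-- Common core of appending and confirming: `lastAck` is raised to `k`, up to which the log is
canonical. -/
theorem Local.Inv.advance (hg : g.Inv) (h : s.Inv g r) {b t k : ℕ} (hb : s.viewBase = some b)
    (hst : s.lastAppend ≤ t) (hkt : k ≤ t) (hak : s.lastAck ≤ k)
    (ht : t = s.lastAppend ∨ t = k) (htb : t < b ∨ k = t)
    (hcan : ∀ m ≤ k, ∃ e, s.log m = some e ∧ g.canon s.view m = some e) :
    Explains g r { s with lastAppend := t, lastAck := k } ∅ := by
  obtain ⟨hbase, hv0, -, -⟩ := h.opened b hb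
  have hx : g.Ext (g.setAcked s.view r k) := ext_setAcked (h.acked_le.trans hak) h.vote
  have hg' := hg.setAcked hbase hx
  refine .of_send hx hg' ?_ (fun q hq => foreign_setAcked hq) (by simp) (by simp)
  have hL := h.toLogInv.mono hx
  have hP := h.toProposalInv.mono hx (fun _ => rfl) fun _ => rfl
  have hE : s.ElectionInv (g.setAcked s.view r k) r :=
    ⟨fun h' => absurd h' (h.role_ne hb), h.request, h.leader, h.vote⟩
  have hself : (g.setAcked s.view r k).acked s.view r = k := by simp [History.setAcked]
  have hother : ∀ x, x ≠ s.view → (g.setAcked s.view r k).acked x r = g.acked x r :=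
    fun x hne => by simp [History.setAcked, hne]
  refine { toProposalInv := ⟨hP.1, hP.2⟩
           toElectionInv := hE.congr rfl (h.role_ne hb)
           commit_le := h.commit_le.trans hak
           ack_le := hkt
           appended := ?_
           matching := ?_
           buffered := fun m e hm he => h.buffered m e (lt_of_le_of_lt hst hm) he
           unopened := fun hs => absurd (hb.symm.trans hs) (by simp)
           opened := ?_
           committed := hL.committed
           ack_valid := .inl hself.ge
           acked_valid := hL.acked_valid
           acked_le := hself.le
           acked_future := fun x hlt => (hother x (ne_of_gt hlt)).trans (h.acked_future x hlt)
           retained := ?_ }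
  · intro n hn
    by_cases hnk : n ≤ k
    · obtain ⟨e, he, hc⟩ := hcan n hnk
      exact ⟨e, he, (hg.canon_view hc).1⟩
    · have hn' : n ≤ t := hn
      exact h.appended n (by omega)
  · intro m n e e' hmn hn he he'
    have hn' : n ≤ t := hn
    by_cases hnk : n ≤ k
    · obtain ⟨e₁, he₁, hc₁⟩ := hcan n hnk
      obtain ⟨e₂, he₂, hc₂⟩ := hcan m (hmn.trans hnk)
      cases he₁.symm.trans he
      cases he₂.symm.trans he'
      exact hg.matching hc₁ hmn hc₂
    · exact h.matching m n e e' hmn (by omega) he he'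
  · intro b' hb'
    cases hb.symm.trans hb'
    refine ⟨hbase, hv0, htb, fun m hm e he => ?_⟩
    obtain ⟨e', he', hc⟩ := hcan m hm
    cases he'.symm.trans he
    exact hc
  · intro x bx k' hbx hbk hk hPr
    by_cases hxv : x = s.view
    · subst hxv
      rw [hself] at hk
      exact ⟨hk.trans hkt, hcan k' hk⟩
    · rw [hother x hxv] at hk
      obtain ⟨h1, h2⟩ := h.retained x bx k' hbx hbk hk fun y h1 h2 => hPr y h1 h2
      exact ⟨h1.trans hst, h2⟩

theorem Local.Inv.canon_of_le_lastAck (h : s.Inv g r) {b : ℕ} (hb : s.viewBase = some b) {m : ℕ}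
    (hm : m ≤ s.lastAck) : ∃ e, s.log m = some e ∧ g.canon s.view m = some e := by
  obtain ⟨e, he, -⟩ := h.appended m (hm.trans h.ack_le)
  exact ⟨e, he, (h.opened b hb).2.2.2 m hm e he⟩

theorem Local.Inv.append (hg : g.Inv) (h : s.Inv g r) {b : ℕ} {e : Entry f α}
    (hb : s.viewBase = some b) (hconf : s.lastAck = s.lastAppend)
    (hlog : s.log (s.lastAppend + 1) = some e) :
    Explains g r { s with lastAppend := s.lastAppend + 1, lastAck := s.lastAppend + 1 } ∅ := by
  refine h.advance hg hb (by omega) le_rfl (by omega) (.inr rfl) (.inr rfl) fun m hm => ?_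
  rcases hm.lt_or_eq with hm | rfl
  · exact h.canon_of_le_lastAck hb (by omega)
  · exact ⟨e, hlog, h.buffered _ e (by omega) hlog⟩

/-- One recovered entry `e` with the same view as the own entry at `n` confirms the log up to `n`: both
the log and the canonical log of the current view agree with `canon e.view` up to there. -/
theorem Local.Inv.confirm (hg : g.Inv) (h : s.Inv g r) {b n : ℕ} {e : Entry f α}
    (hb : s.viewBase = some b) (hc : g.canon s.view n = some e) (hn : s.lastAck < n)
    (hn' : n ≤ s.lastAppend) (hev : (s.log n).map Entry.view = some e.view) :
    Explains g r { s with lastAck := n } ∅ := by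
  obtain ⟨hbase, -, hor, -⟩ := h.opened b hb
  refine h.advance hg hb le_rfl hn' hn.le (.inl rfl) (.inl (by omega)) fun m hm => ?_
  obtain ⟨e₁, he₁, -⟩ := h.appended n hn'
  obtain ⟨e₂, he₂, -⟩ := h.appended m (hm.trans hn')
  have hview : e₁.view = e.view := by simpa [he₁] using hev
  have h2 := h.matching m n e₁ e₂ hm hn' he₁ he₂
  refine ⟨e₂, he₂, ?_⟩
  -- Here `lastAck < lastAppend`, so that nothing has been appended from the base on.
  obtain ⟨e₃, he₃⟩ := hg.canon_defined hbase (m := m) (by omega)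
  have h3 := hg.matching hc hm he₃
  rw [← hview, h2] at h3
  cases h3
  exact he₃

theorem Local.Inv.deliverRecover (hg : g.Inv) (h : s.Inv g r) {n : ℕ} {e : Entry f α}
    (hk : g.Known s.view n e) : Explains g r (s.deliverRecover n e) ∅ := by
  unfold Local.deliverRecover
  split_ifs with h1 h2 h3 h4 h5
  · refine .of_same hg (h.learnViewInit hg h1 ?_ h2.2 h2.1)
    rcases hk with hk | ⟨u, k, hu, -, -, hc⟩
    · exact hk
    · have := (hg.canon_view hc).1
      have := h2.2
      omega
  · exact .of_same hg h
  · exact .of_same hg h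
  all_goals
    obtain ⟨b, hb⟩ := Option.ne_none_iff_exists'.1 h1
    have hc := hg.canon_of_known (h.opened b hb).1 hk
  · exact h.confirm hg hb hc (by omega) h4 h5
  · exact .of_same hg (h.replaceFrom hg hb hc (by omega) h4 h5)
  · exact .of_same hg (h.buffer (h.role_ne hb) hc fun hs => absurd hs h1)

theorem Local.Inv.known_of_log (h : s.Inv g r) {n : ℕ} {e : Entry f α} (hlog : s.log n = some e)
    (hok : n ≤ s.lastAck ∨ e.view = s.view) : g.Known s.view n e := by
  by_cases hn : s.lastAppend < n
  · exact .inl (h.buffered n e hn hlog)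
  rcases hok with hok | hok
  · cases hb : s.viewBase with
    | some b => exact .inl ((h.opened b hb).2.2.2 n hok e hlog)
    | none =>
      rw [(h.unopened hb).1] at hok
      obtain ⟨u, k, h1, h2, h3, h4, h5⟩ := h.committed
      have hc := h5 n hok e hlog
      rcases h4 hb with h4 | h4
      · exact .inr ⟨u, k, h4, hok.trans h2, h1, hc⟩
      · have : u = s.view := by omega
        exact .inl (this ▸ hc)
  · exact .inl (hok ▸ h.matching n n e e le_rfl (by omega) hlog hlog)

theorem Local.Inv.proposeAt (hg : g.Inv) (h : s.Inv g r) {owner : ℕ → Replica f} {n : ℕ}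
    {c : Command f α} (hnext : s.nextPropose = some n) (hscheme : s.scheme = some owner)
    (hc : c = Command.noop ∨ ∃ ops, c = Command.request ops) :
    Explains g r (s.proposeAt r owner n c) {Message.propose s.view n s.lastAck c} := by
  obtain ⟨b, owner', hb, hcb, hbn, hown, hbc⟩ := h.next n hnext
  have := h.canon_of_scheme hg hb hscheme
  rw [hcb] at this
  obtain rfl : owner' = owner := by simpa using this
  obtain ⟨hbase, hv0, hor, hopen⟩ := h.opened b hb
  have hnone : g.canon s.view n = none := by
    cases hcn : g.canon s.view n with
    | none => rfl
    | some e =>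
      have := ((h.own _ _ _ _ _ hbase hbn hcb hown hcn).2 rfl).2.2 n hnext
      omega
  set e : Entry f α := ⟨s.view, c⟩ with he
  have hvi : ¬ e.IsViewInit := by
    rintro ⟨o, ho⟩
    rcases hc with rfl | ⟨ops, rfl⟩ <;> exact absurd ho (by simp [he])
  have hx : g.Ext (g.extend s.view n e) := ext_extend hnone
  have hnew : (g.extend s.view n e).canon s.view n = some e := by simp [History.extend]
  have hsame : ∀ {x m}, ¬ (x = s.view ∧ m = n) →
      (g.extend s.view n e).canon x m = g.canon x m := fun h => if_neg h
  -- The proposal overwrites no appended entry, as these are canonical from the base on.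
  have happ : s.lastAppend < n := by
    by_contra! hle
    obtain ⟨e', he'⟩ := h.canon_of_le_lastAck hb (m := n) (by omega)
    exact absurd (hnone.symm.trans he'.2) (by simp)
  have hca := h.commit_le.trans h.ack_le
  have hlow : ∀ m, m ≤ s.lastAppend → Function.update s.log n (some e) m = s.log m :=
    fun m hm => Function.update_of_ne (by omega) _ _
  have hL := h.toLogInv.mono hx
  have hA := h.toAckInv.mono hx hg.toLogInv fun _ => rfl
  have hE : s.ElectionInv (g.extend s.view n e) r :=
    ⟨fun h' => absurd h' (h.role_ne hb), h.request, h.leader, h.vote⟩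
  have hnp : ∀ p, nextAssigned owner' r n = some p → n < p ∧ owner' p = r := by
    intro p hp
    simp only [nextAssigned] at hp
    split_ifs at hp with hex
    cases hp
    classical exact Nat.find_spec hex
  refine .of_send hx (hg.extend hbase hbn hnone rfl hvi) ?_ ?_ ?_ (by simp)
  · refine { toElectionInv := hE.congr rfl (h.role_ne hb)
             commit_le := h.commit_le
             ack_le := h.ack_le
             appended := fun m hm => ?_
             matching := fun m i e₁ e₂ hmi hi he₁ he₂ => ?_
             buffered := fun m e' hm he' => ?_
             unopened := fun hs => absurd (hb.symm.trans hs) (by simp)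
             opened := fun b' hb' => ?_
             committed := ?_
             ack_valid := hL.ack_valid
             acked_valid := hL.acked_valid
             acked_le := hA.acked_le
             acked_future := hA.acked_future
             retained := fun x bx k hbx hbk hk hPr => ?_
             own := fun x bx m o e' h1 h2 h3 h4 h5 => ?_
             next := fun p hp => ?_ }
    · obtain ⟨e', he', hv⟩ := h.appended m hm
      exact ⟨e', (hlow m hm).trans he', hv⟩
    · exact hL.matching m i e₁ e₂ hmi hi ((hlow i hi).symm.trans he₁)
        ((hlow m (hmi.trans hi)).symm.trans he₂)
    · by_cases hmn : m = n
      · subst hmn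
        cases (Function.update_self m _ s.log).symm.trans he'
        exact hnew
      · exact hL.buffered m e' hm ((Function.update_of_ne hmn _ _).symm.trans he')
    · obtain ⟨h1, h2, h3, h4⟩ := hL.opened b' hb'
      exact ⟨h1, h2, h3, fun m hm e' he' =>
        h4 m hm e' ((hlow m (le_trans hm h.ack_le)).symm.trans he')⟩
    · obtain ⟨u, k, h1, h2, h3, h4, h5⟩ := hL.committed
      exact ⟨u, k, h1, h2, h3, h4,
        fun m hm e' he' => h5 m hm e' ((hlow m (le_trans hm hca)).symm.trans he')⟩
    · obtain ⟨h1, e', h2, h3⟩ := hA.retained x bx k hbx hbk hk hPr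
      exact ⟨h1, e', (hlow k h1).trans h2, h3⟩
    · have hcx : g.canon x bx = some ⟨x, Command.viewInit o⟩ := by
        rcases extend_canon h3 with h | ⟨-, -, h⟩
        · exact h
        · exact absurd ⟨o, (congrArg Entry.cmd h).symm⟩ hvi
      rcases extend_canon h5 with h5 | ⟨rfl, rfl, -⟩
      · obtain ⟨k1, k2⟩ := h.own x bx m o e' h1 h2 hcx h4 h5
        refine ⟨k1, fun hxv => ?_⟩
        obtain ⟨k3, k4, k5⟩ := k2 hxv
        refine ⟨k3, k4, fun p hp => ?_⟩
        exact (k5 n hnext).trans (hnp p hp).1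
      · cases hbase.symm.trans h1
        exact ⟨le_rfl, fun _ => ⟨hb, hbc, fun p hp => (hnp p hp).1⟩⟩
    · obtain ⟨h1, h2⟩ := hnp p hp
      exact ⟨b, owner', hb, (hsame (by omega)).trans hcb, hbn.trans h1, h2, hbc⟩
  · intro q hq
    refine ⟨fun _ => rfl, fun {x bx m o e'} h1 h2 h3 h4 h5 => ?_, id, fun h h' => ⟨h, h'⟩, id⟩
    have hcx : g.canon x bx = some ⟨x, Command.viewInit o⟩ := by
      rcases extend_canon h3 with h | ⟨-, -, h⟩
      · exact h
      · exact absurd ⟨o, (congrArg Entry.cmd h).symm⟩ hvi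
    refine ⟨h1, hcx, ?_⟩
    rcases extend_canon h5 with h5 | ⟨rfl, rfl, -⟩
    · exact h5
    · cases hbase.symm.trans h1
      rw [hcb] at hcx
      obtain rfl : owner' = o := by simpa using hcx
      exact absurd (h4.symm.trans hown) hq
  · intro m hm
    cases hm
    exact ⟨hv0, hnew, h.ack_valid.mono hx⟩

/-- A view has at most one leader, because quorums intersect; and that leader is no candidate any
more. -/
theorem Local.Inv.base_eq_none (hg : g.Inv) (h : s.Inv g r) (hr : s.role = Role.candidate)
    (hq : f + 1 ≤ s.votedBy.card) : g.base s.view = none := by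
  cases hb : g.base s.view with
  | none => rfl
  | some b =>
    obtain ⟨-, hv0, -, hvotes⟩ := h.candidate hr
    obtain ⟨e, Q, -, hQ, hQv⟩ := hg.elected hb hv0
    obtain ⟨q, hq1, hq2⟩ := exists_mem_of_quorums hQ hq
    have h1 := (hQv q hq1).1
    rw [(hvotes q hq2).1] at h1
    exact absurd hr ((h.leader _ _ hb hv0 (Option.some.inj h1).symm).2 rfl)

/-- A candidate with a quorum of votes opens its view: the canonical log of the view is its own log,
with the `viewInit` added, and its votes become those of `History.Elected`. -/
theorem Local.Inv.initiate (hg : g.Inv) (h : s.Inv g r) (owner : ℕ → Replica f)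
    (hr : s.role = Role.candidate) (hq : f + 1 ≤ s.votedBy.card) :
    Explains g r (s.initiate owner) {Message.propose s.view (s.lastAppend + 1) (s.lastAppend + 1)
      (Command.viewInit owner)} := by
  have hnone := h.base_eq_none hg hr hq
  obtain ⟨hvb, hv0, hcand, hvotes⟩ := h.candidate hr
  set v := s.view with hv
  set t := s.lastAppend with ht
  set log := (s.initiate owner).log with hlogdef
  have hca := h.commit_le.trans h.ack_le
  have hlow : ∀ m, m ≤ t → log m = s.log m := fun m hm => Function.update_of_ne (by omega) _ _
  have hmid : log (t + 1) = some ⟨v, Command.viewInit owner⟩ := Function.update_self _ _ _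
  have hlog : ∀ m e, log m = some e →
      (m ≤ t ∧ s.log m = some e ∧ e.view < v) ∨
        (m = t + 1 ∧ e = ⟨v, Command.viewInit owner⟩) := by
    intro m e he
    by_cases hm : m = t + 1
    · subst hm
      rw [hmid] at he
      exact .inr ⟨rfl, (Option.some.inj he).symm⟩
    · have he' : s.log m = some e := (Function.update_of_ne hm _ _).symm.trans he
      exact .inl ⟨(hcand m e he').1, he', (hcand m e he').2⟩
  have hcnone : ∀ m, g.canon v m = none := fun m => by
    cases hc : g.canon v m with
    | none => rfl
    | some e =>
      obtain ⟨-, b, hb, -⟩ := hg.canon_view hc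
      exact absurd (hnone.symm.trans hb) (by simp)
  set g₁ := g.openView v (t + 1) r log with hg₁
  have hbase : g₁.base v = some (t + 1) := if_pos rfl
  have hcanon : g₁.canon v = log := if_pos rfl
  have hleader : g₁.leader v = r := if_pos rfl
  have hacked : g₁.acked v r = t + 1 := if_pos ⟨rfl, rfl⟩
  have hbase' : ∀ {x}, x ≠ v → g₁.base x = g.base x := fun hx => if_neg hx
  have hcanon' : ∀ {x}, x ≠ v → g₁.canon x = g.canon x := fun hx => if_neg hx
  have hleader' : ∀ {x}, x ≠ v → g₁.leader x = g.leader x := fun hx => if_neg hx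
  have hacked' : ∀ {x q}, ¬ (x = v ∧ q = r) → g₁.acked x q = g.acked x q := fun hx => if_neg hx
  have hx : g.Ext g₁ := by
    have hne : ∀ {x b}, g.base x = some b → x ≠ v := by
      rintro x b hb rfl
      exact absurd (hnone.symm.trans hb) (by simp)
    refine ⟨fun hb => (hbase' (hne hb)).trans hb, fun hb => hleader' (hne hb), ?_, ?_, id,
      subset_rfl, ?_, ?_⟩
    · intro x n e hc
      have hxv : x ≠ v := by
        rintro rfl
        exact absurd ((hcnone n).symm.trans hc) (by simp)
      rwa [hcanon' hxv]
    · intro x q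
      by_cases hif : x = v ∧ q = r
      · rw [hif.1, hg.acked_none q hnone]
        exact Nat.zero_le _
      · rw [hacked' hif]
    · intro w q c x hw hlt
      refine hacked' ?_
      rintro ⟨rfl, rfl⟩
      have := h.vote w c hw
      omega
    · intro x b hb hb'
      by_cases hxv : x = v
      · subst hxv
        cases hbase.symm.trans hb'
        omega
      · rw [hbase' hxv, hb] at hb'
        exact absurd hb' (by simp)
  have hmatch : ∀ m n e e', m ≤ n → log n = some e → log m = some e' →
      g₁.canon e.view m = some e' := by
    intro m n e e' hmn he he'
    rcases hlog n e he with ⟨hn, hsn, -⟩ | ⟨-, rfl⟩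
    · rw [hlow m (hmn.trans hn)] at he'
      exact hx.canon (h.matching m n e e' hmn hn hsn he')
    · rwa [hcanon]
  have hg' : g₁.Inv := by
    refine { base_zero := hx.base hg.base_zero
             canon_view := ?_
             canon_defined := ?_
             base_pos := ?_
             viewInit := ?_
             matching := ?_
             acked_none := ?_
             elected := ?_
             msgs := fun hm => (hg.msgs hm).mono hx hg.toLogInv }
    · intro x n e hc
      by_cases hxv : x = v
      · subst hxv
        rw [hcanon] at hc
        rcases hlog n e hc with ⟨hn, -, hev⟩ | ⟨rfl, rfl⟩
        · exact ⟨hev.le, _, hbase, iff_of_false hev.ne (by omega)⟩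
        · exact ⟨le_rfl, _, hbase, iff_of_true rfl le_rfl⟩
      · rw [hcanon' hxv] at hc
        rw [hbase' hxv]
        exact hg.canon_view hc
    · intro x b m hb hm
      by_cases hxv : x = v
      · subst hxv
        cases hbase.symm.trans hb
        rw [hcanon]
        rcases hm.lt_or_eq with hm | rfl
        · rw [hlow m (by omega)]
          obtain ⟨e, he, -⟩ := h.appended m (by omega)
          exact ⟨e, he⟩
        · exact ⟨_, hmid⟩
      · rw [hbase' hxv] at hb
        rw [hcanon' hxv]
        exact hg.canon_defined hb hm
    · intro x b hb hx0
      by_cases hxv : x = v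
      · subst hxv
        cases hbase.symm.trans hb
        omega
      · rw [hbase' hxv] at hb
        exact hg.base_pos hb hx0
    · intro x n e hc hev hvi
      by_cases hxv : x = v
      · subst hxv
        rw [hcanon] at hc
        rcases hlog n e hc with ⟨-, -, hlt⟩ | ⟨rfl, -⟩
        · omega
        · exact ⟨hbase, hv0⟩
      · rw [hcanon' hxv] at hc
        rw [hbase' hxv]
        exact hg.viewInit hc hev hvi
    · intro x n m e e' hc hm hc'
      by_cases hxv : x = v
      · subst hxv
        rw [hcanon] at hc hc'
        exact hmatch m n e e' hm hc hc'
      · rw [hcanon' hxv] at hc hc'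
        exact hx.canon (hg.matching hc hm hc')
    · intro x q hb
      by_cases hxv : x = v
      · subst hxv
        exact absurd (hbase.symm.trans hb) (by simp)
      · rw [hbase' hxv] at hb
        rw [hacked' fun h' => hxv h'.1]
        exact hg.acked_none q hb
    · intro w b hb hw
      by_cases hwv : w = v
      · subst hwv
        cases hbase.symm.trans hb
        obtain ⟨e, he, -⟩ := h.appended t le_rfl
        have hlav : s.lastAppendView = e.view := by
          simp [Local.lastAppendView, ← ht, he]
        refine ⟨e, s.votedBy, ?_, hq, fun q hqv => ?_⟩
        · rw [hcanon, Nat.add_sub_cancel, hlow t le_rfl]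
          exact he
        · obtain ⟨k1, k2⟩ := hvotes q hqv
          rw [hleader, Nat.add_sub_cancel, ← hlav]
          exact ⟨k1, k2.mono hx hg.toLogInv k1⟩
      · rw [hbase' hwv] at hb
        exact (hg.elected hb hw).mono hx hg.toLogInv hb
  have hL := h.toLogInv.mono hx
  refine .of_send hx hg' ?_ ?_ ?_ (by simp)
  · refine { commit_le := hca.trans (Nat.le_succ t)
             ack_le := le_rfl
             appended := fun n hn => ?_
             matching := fun m n e e' hmn hn he he' => hmatch m n e e' hmn he he'
             buffered := fun m e hm he => ?_
             unopened := fun hs => absurd hs (by simp [Local.initiate])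
             opened := fun b hb => ?_
             committed := ?_
             ack_valid := .inl hacked.ge
             acked_valid := hL.acked_valid
             acked_le := hacked.le
             acked_future := fun x hlt => ?_
             retained := fun x b k hb hbk hk hP => ?_
             own := fun x b n o e h1 h2 h3 h4 h5 => ?_
             next := fun p hp => ?_
             candidate := fun h' => absurd h' (by simp [Local.initiate])
             request := fun w i u hm => ?_
             leader := fun x b hb hx0 hl => ?_
             vote := h.vote }
    · obtain hn | rfl := Nat.le_or_eq_of_le_succ (show n ≤ t + 1 from hn)
      · obtain ⟨e, he, hle⟩ := h.appended n hn
        exact ⟨e, (hlow n hn).trans he, hle⟩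
      · exact ⟨_, hmid, le_rfl⟩
    · show g₁.canon v m = some e
      rw [hcanon]
      exact he
    · obtain rfl : t + 1 = b := by simpa [Local.initiate] using hb
      refine ⟨hbase, hv0, .inr rfl, fun m hm e he => ?_⟩
      show g₁.canon v m = some e
      rw [hcanon]
      exact he
    · obtain ⟨u, k, h1, h2, h3, h4, h5⟩ := hL.committed
      refine ⟨u, k, h1, h2, h3, fun _ => h4 hvb, fun m hm e he => ?_⟩
      exact h5 m hm e ((hlow m (le_trans hm hca)).symm.trans he)
    · have hlt' : v < x := hlt
      rw [hacked' fun h' => by omega]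
      exact h.acked_future x hlt'
    · by_cases hxv : x = v
      · subst hxv
        cases hbase.symm.trans hb
        rw [hacked] at hk
        obtain rfl : k = t + 1 := by omega
        exact ⟨le_rfl, _, hmid, by rw [hcanon]; exact hmid⟩
      · rw [hbase' hxv] at hb
        rw [hacked' fun h' => hxv h'.1] at hk
        obtain ⟨h1, e, h2, h3⟩ := h.retained x b k hb hbk hk
          fun y h1 h2 => (hP y h1 h2).of_ext hx hg.toLogInv
        exact ⟨h1.trans (Nat.le_succ t), e, (hlow k h1).trans h2, hx.canon h3⟩
    · by_cases hxv : x = v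
      · subst hxv
        cases hbase.symm.trans h1
        rw [hcanon] at h5
        rcases hlog n e h5 with h6 | h6 <;> omega
      · rw [hbase' hxv] at h1
        rw [hcanon' hxv] at h3 h5
        exact ⟨(h.own x b n o e h1 h2 h3 h4 h5).1, fun h' => absurd h' hxv⟩
    · obtain ⟨b, _, hb, -⟩ := h.next p hp
      exact absurd (hvb.symm.trans hb) (by simp)
    · exact ⟨(h.request w i u hm).1, fun _ h' => absurd h' (by simp [Local.initiate])⟩
    · refine ⟨?_, fun _ => by simp [Local.initiate]⟩
      by_cases hxv : x = v
      · exact hxv.le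
      · rw [hbase' hxv] at hb
        rw [hleader' hxv] at hl
        exact (h.leader x b hb hx0 hl).1
  · intro q hqr
    refine ⟨fun x => hacked' fun h' => hqr h'.2, fun {x b n o e} h1 h2 h3 h4 h5 => ?_, id,
      fun {x b} h1 h2 => ?_, id⟩
    · by_cases hxv : x = v
      · subst hxv
        cases hbase.symm.trans h1
        rw [hcanon] at h5
        rcases hlog n e h5 with h6 | h6 <;> omega
      · rw [hbase' hxv] at h1
        rw [hcanon' hxv] at h3 h5
        exact ⟨h1, h3, h5⟩
    · by_cases hxv : x = v
      · subst hxv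
        exact absurd (h2.symm.trans hleader) hqr
      · rw [hbase' hxv] at h1
        rw [hleader' hxv] at h2
        exact ⟨h1, h2⟩
  · intro m hm
    cases hm
    exact ⟨hv0, by rw [hcanon]; exact hmid, .inl hacked.ge⟩

/-- Every local step preserves the invariant, for a suitable extension of the history. -/
theorem LocalStep.explains {net : Network f α} (hstep : LocalStep r net s s' out) (hg : g.Inv)
    (h : s.Inv g r) (hnet : net ⊆ g.sent) : Explains g r s' out := by
  cases hstep with
  | startElection v hv => exact h.startElection hg hv
  | vote c v n w hm hv hlog => exact h.castVote hg hv (hnet hm) hlog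
  | receiveVote q hm hrole => exact .of_same hg (h.receiveVote hg (hnet hm) hrole)
  | becomeInitiator owner hrole hq => exact h.initiate hg owner hrole hq
  | propose owner n c hnext hscheme hc => exact h.proposeAt hg hnext hscheme hc
  | proposeAgain n a c hm =>
    obtain ⟨h1, h2, -⟩ := hg.msgs (hnet hm)
    exact .of_msg hg h ⟨h1, h2, h.ack_valid⟩ (by simp)
  | sendAck => exact .of_msg hg h h.ack_valid (by simp)
  | sendNack n => exact .of_msg hg h trivial (by simp)
  | answerNack q n e hm hlog hok => exact .of_msg hg h (h.known_of_log hlog hok) (by simp)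
  | receivePropose q v n a c hm hv =>
    obtain ⟨-, hc, ha⟩ := hg.msgs (hnet hm)
    obtain ⟨h1, h2, h3⟩ := h.followProposal hv
    generalize s.followProposal v = s₁ at h1 h2 h3 ⊢
    subst h2
    refine .of_same hg ((h1.deliver hg h3 hc rfl).receiveAck ?_)
    rw [deliver_view]
    exact ha
  | receiveAck q a hm => exact .of_same hg (h.receiveAck (hg.msgs (hnet hm)))
  | receiveRecover q n e hm => exact h.deliverRecover hg (hg.msgs (hnet hm))
  | append b e hb hconf hlog => exact h.append hg hb hconf hlog
  | commit b k hb hbk hnew hown hq => exact .of_same hg (h.commitUpTo hg hb hbk hnew hown hq)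
  | switchMode m =>
    exact .of_same hg { h with
                        toProposalInv := ⟨h.own, h.next⟩
                        toElectionInv := ⟨h.candidate, h.request, h.leader, h.vote⟩ }

theorem LocalStep.outbox_eq {net : Network f α} (hstep : LocalStep r net s s' out) :
    s'.outbox = s.outbox := by
  have hfollow : ∀ v, (s.followProposal v).outbox = s.outbox := fun v => by
    unfold Local.followProposal
    split_ifs
    · rfl
    · split <;> rfl
  have hdeliver : ∀ (s : Local f α) n e, (s.deliver n e).outbox = s.outbox := fun s n e => by
    unfold Local.deliver Local.buffer
    split_ifs <;> rfl
  cases hstep with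
  | receivePropose q v n a c hm hv => exact (hdeliver _ _ _).trans (hfollow v)
  | receiveRecover q n e hm =>
    unfold Local.deliverRecover Local.buffer
    split_ifs <;> rfl
  | _ => rfl

theorem Local.Inv.setOutbox (h : s.Inv g r) (o : Set (Message f α)) :
    Local.Inv g r { s with outbox := o } :=
  { h with
    toProposalInv := ⟨h.own, h.next⟩
    toElectionInv := ⟨h.candidate, h.request, h.leader, h.vote⟩ }

end Steps

/-! ### Executions -/

/-- The invariant of the system, relative to the history `g`. -/
structure State.Inv (g : History f α) (σ : State f α) : Prop where
  history : g.Inv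
  replica : ∀ r, (σ.replica r).Inv g r
  net : σ.net ⊆ g.sent
  outbox : ∀ r, ∀ m ∈ (σ.replica r).outbox, (r, m) ∈ g.sent

/-- The history of the initial state. View `0` counts as opened at slot `0`, where all replicas have
acknowledged the null command, so that slot `0` is chosen. -/
def History.start (f : ℕ) (α : Type*) : History f α where
  base v := if v = 0 then some 0 else none
  leader _ := 0
  canon v n := if v = 0 ∧ n = 0 then some ⟨0, Command.null⟩ else none
  acked _ _ := 0
  vote _ _ := none
  sent := ∅

theorem State.inv_start : (State.start f α).Inv (History.start f α) := by
  have hc : ∀ {v n e}, (History.start f α).canon v n = some e →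
      v = 0 ∧ n = 0 ∧ e = ⟨0, Command.null⟩ := by
    intro v n e h
    simp only [History.start] at h
    split_ifs at h with hif
    exact ⟨hif.1, hif.2, (Option.some.inj h).symm⟩
  have hb : ∀ {v b}, (History.start f α).base v = some b → v = 0 ∧ b = 0 := by
    intro v b h
    simp only [History.start] at h
    split_ifs at h with hif
    exact ⟨hif, (Option.some.inj h).symm⟩
  have hlog : ∀ {n e}, (Local.start f α).log n = some e → n = 0 ∧ e = ⟨0, Command.null⟩ := by
    intro n e h
    simp only [Local.start] at h
    split_ifs at h with hif
    exact ⟨hif, (Option.some.inj h).symm⟩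
  refine ⟨⟨⟨rfl, ?_, ?_, ?_, ?_, ?_, fun _ _ => rfl⟩, ?_, fun h => absurd h (Set.notMem_empty _)⟩,
    fun r => ⟨⟨le_rfl, le_rfl, ?_, ?_, ?_, ?_, ?_, ?_, .inl le_rfl, fun _ => .inl le_rfl⟩,
      ⟨le_rfl, fun _ _ => rfl, ?_⟩, ⟨?_, fun p h => absurd h (by simp [State.start, Local.start])⟩,
      ⟨fun h => absurd h (by simp [State.start, Local.start]),
        fun _ _ _ h => absurd h (Set.notMem_empty _), ?_,
        fun _ _ h => absurd h (by simp [History.start])⟩⟩,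
    Set.empty_subset _, fun _ _ h => absurd h (Set.notMem_empty _)⟩
  · intro v n e h
    obtain ⟨rfl, rfl, rfl⟩ := hc h
    exact ⟨le_rfl, 0, rfl, iff_of_true rfl le_rfl⟩
  · intro v b m h hm
    obtain ⟨rfl, rfl⟩ := hb h
    obtain rfl : m = 0 := by omega
    exact ⟨_, rfl⟩
  · intro v b h h0
    exact absurd (hb h).1 h0
  · intro v n e h _ hvi
    obtain ⟨rfl, rfl, rfl⟩ := hc h
    obtain ⟨o, ho⟩ := hvi
    exact absurd ho (by simp)
  · intro v n m e e' h _ h'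
    obtain ⟨rfl, rfl, rfl⟩ := hc h
    exact h'
  · intro w b h h0
    exact absurd (hb h).1 h0
  · intro n hn
    obtain rfl : n = 0 := Nat.le_zero.1 hn
    exact ⟨_, rfl, le_rfl⟩
  · intro m n e e' _ _ h h'
    obtain ⟨rfl, rfl⟩ := hlog h
    obtain ⟨rfl, rfl⟩ := hlog h'
    rfl
  · intro m e hm h
    obtain ⟨rfl, rfl⟩ := hlog h
    exact absurd hm (lt_irrefl 0)
  · intro _
    refine ⟨rfl, fun m e hm h => ?_⟩
    obtain ⟨rfl, rfl⟩ := hlog h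
    rfl
  · intro b h
    exact absurd h (by simp [State.start, Local.start])
  · refine ⟨0, 0, ⟨0, Finset.univ, rfl, le_rfl, ?_, fun _ _ => le_rfl⟩, le_rfl, le_rfl,
      fun _ => .inr rfl, fun m _ e h => ?_⟩
    · rw [Finset.card_univ, Fintype.card_fin]
      omega
    · obtain ⟨rfl, rfl⟩ := hlog h
      rfl
  · intro x b k h _ hk _
    obtain ⟨rfl, rfl⟩ := hb h
    obtain rfl : k = 0 := Nat.le_zero.1 hk
    exact ⟨le_rfl, _, rfl, rfl⟩
  · intro x b n o e _ hbn _ _ h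
    have := (hc h).2.1
    omega
  · intro x b h h0
    exact absurd (hb h).1 h0

theorem State.Inv.step {g : History f α} {σ σ' : State f α} (h : σ.Inv g) (hstep : Step σ σ') :
    ∃ g', g.Ext g' ∧ σ'.Inv g' := by
  cases hstep with
  | responsive r s' out _ _ hl =>
    obtain ⟨g', hx, hg', hs', hout, hf⟩ := hl.explains h.history (h.replica r) h.net
    refine ⟨g', hx, hg', fun q => ?_, ?_, fun q => ?_⟩
    · by_cases hq : q = r
      · subst hq
        simpa using hs'
      · simpa [hq] using (h.replica q).mono hx h.history.toLogInv (hf q hq)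
    · rintro ⟨q, m⟩ (hm | ⟨rfl, hm⟩)
      · exact hx.sent (h.net hm)
      · exact hout m hm
    · by_cases hq : q = r
      · subst hq
        simpa [hl.outbox_eq] using fun m hm => hx.sent (h.outbox q m hm)
      · simpa [hq] using fun m hm => hx.sent (h.outbox q m hm)
  | pulsing r s' out _ _ hl =>
    obtain ⟨g', hx, hg', hs', hout, hf⟩ := hl.explains h.history (h.replica r) h.net
    refine ⟨g', hx, hg', fun q => ?_, h.net.trans hx.sent, fun q => ?_⟩
    · by_cases hq : q = r
      · subst hq
        simpa using hs'.setOutbox _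
      · simpa [hq] using (h.replica q).mono hx h.history.toLogInv (hf q hq)
    · by_cases hq : q = r
      · subst hq
        simp only [Function.update_self, hl.outbox_eq]
        rintro m (hm | hm)
        · exact hx.sent (h.outbox q m hm)
        · exact hout m hm
      · simpa [hq] using fun m hm => hx.sent (h.outbox q m hm)
  | pulse r _ =>
    refine ⟨g, .refl g, h.history, fun q => ?_, ?_, fun q => ?_⟩
    · by_cases hq : q = r
      · subst hq
        simpa using (h.replica q).setOutbox _
      · simpa [hq] using h.replica q
    · rintro ⟨q, m⟩ (hm | ⟨rfl, hm⟩)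
      · exact h.net hm
      · exact h.outbox _ m hm
    · by_cases hq : q = r
      · subst hq
        simp
      · simpa [hq] using h.outbox q
  | crash r => exact ⟨g, .refl g, h.history, h.replica, h.net, h.outbox⟩

theorem State.Inv.steps {g : History f α} {σ σ' : State f α} (h : σ.Inv g)
    (hs : Relation.ReflTransGen Step σ σ') : ∃ g', g.Ext g' ∧ σ'.Inv g' := by
  induction hs with
  | refl => exact ⟨g, .refl g, h⟩
  | tail _ hstep ih =>
    obtain ⟨g₁, hx₁, h₁⟩ := ih
    obtain ⟨g₂, hx₂, h₂⟩ := h₁.step hstep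
    exact ⟨g₂, hx₁.trans hx₂, h₂⟩

/-- A committed command is in the canonical log of some view, at a slot up to a chosen one. -/
theorem State.Inv.chosen_of_committed {g : History f α} {σ : State f α} (h : σ.Inv g) {n : ℕ}
    {c : Entry f α} (hc : σ.Committed n c) :
    ∃ v k, g.Chosen v k ∧ n ≤ k ∧ g.canon v n = some c := by
  obtain ⟨r, hn, hlog⟩ := hc
  obtain ⟨v, k, h1, h2, -, -, h5⟩ := (h.replica r).committed
  exact ⟨v, k, h1, hn.trans h2, h5 n hn c hlog⟩

end Chora

theorem theorem1 (f : ℕ) {α : Type*} (σ σ' : Chora.State f α)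
    (hσ : Relation.ReflTransGen Chora.Step (Chora.State.start f α) σ)
    (hσ' : Relation.ReflTransGen Chora.Step σ σ')
    (n : ℕ) (c c' : Chora.Entry f α) (hc : σ.Committed n c) (hc' : σ'.Committed n c') :
    c' = c := by
  obtain ⟨g, -, hg⟩ := Chora.State.inv_start.steps hσ
  obtain ⟨g', hx, hg'⟩ := hg.steps hσ'
  obtain ⟨v, k, h1, h2, h3⟩ := hg.chosen_of_committed hc
  obtain ⟨v', k', h1', h2', h3'⟩ := hg'.chosen_of_committed hc'
  exact hg'.history.canon_eq_of_chosen (h1.mono hx) h1' h2 h2' (hx.canon h3) h3'
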